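/- Let $\Sigma$ be a smooth three-manifold and let $\mathcal{I}\subset\mathbb{R}$ be an open interval. Let $\{\beta_t\}_{t\in\mathcal{I}}$ be a smooth family of strictly positive functions on $\Sigma$ and let $\{\mathfrak{e}^t=(e^t_u,e^t_l,e^t_n)\}_{t\in\mathcal{I}}$ be a smooth family of global coframes on $\Sigma$. Set $$h_t = e^t_u\otimes e^t_u + e^t_l\otimes e^t_l + e^t_n\otimes e^t_n\,,\qquad \Theta_t = -\frac{1}{2\beta_t}\,\partial_t h_t\,,$$ and, for a one-form $\alpha$ on $\Sigma$ with $h_t$-dual vector field $\alpha^{\sharp}$, write $\Theta_t(\alpha):=\Theta_t(\alpha^{\sharp},\cdot)$ and $\mathrm{d}\beta_t(\alpha):=\mathrm{d}\beta_t(\alpha^{\sharp})$. Suppose that $\{\beta_t,\mathfrak{e}^t\}_{t\in\mathcal{I}}$ is a parallel spinor flow, that is, for all $t\in\mathcal{I}$ and $a\in\{u,l,n\}$, $$\partial_t e^t_a + \mathrm{d}\beta_t(e^t_a)\, e^t_u + \beta_t\Theta_t(e^t_a) = \delta_{au}\,\mathrm{d}\beta_t\,,\qquad \mathrm{d} e^t_a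 = \Theta_t(e^t_a)\wedge e^t_u\,,$$ $$\partial_t(\Theta_t(e^t_u)) + \mathrm{d}(\mathrm{d}\beta_t(e^t_u)) = 0\,,\qquad [\Theta_t(e^t_u)] = 0\in H^1(\Sigma,\mathbb{R})\,.$$ Then there exists a smooth family of functions $\{\mathfrak{f}_t\}_{t\in\mathcal{I}}$ on $\Sigma$ (smooth on $\mathcal{I}\times\Sigma$) such that $$\mathrm{d}\mathfrak{f}_t = -\Theta_t(e^t_u)\,,\qquad \partial_t\mathfrak{f}_t = \mathrm{d}\beta_t(e^t_u)\,,$$ and for every such family the Ricci tensor of the Lorentzian metric $g = -\beta_t^2\,\mathrm{d}t\otimes\mathrm{d}t + h_t$ on $M=\mathcal{I}\times\Sigma$ is $$\mathrm{Ric}^g = \frac{1}{2}\,\mathcal{H}\, e^{-2\mathfrak{f}_t}\, u\otimes u\,,$$ where $u = e^{\mathfrak{f}_t}(\beta_t\,\mathrm{d}t + e^t_u)$ is the Dirac current and $\mathcal{H}$ is the Hamiltonian function on $M$, $$\mathcal{H}(t,p) = \big(\mathrm{R}_{h_t} - |\Theta_t|^2_{h_t} + \mathrm{Tr}_{h_t}(\Theta_t)^2\big)\big|_p\,,$$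 with $\mathrm{R}_{h_t}$ the scalar curvature of $h_t$. -/

import Mathlib

set_option maxSynthPendingDepth 3

open Set
open scoped Manifold ContDiff Topology

noncomputable section

namespace SpinorFlow

/-! ### Levi-Civita connection and Ricci tensor on a finite-dimensional vector space

A metric on (an open subset of) `E` is a field `G` of symmetric nondegenerate bilinear forms, each
regarded as the map `E → E*`, `v ↦ G(v, ·)`, whose inverse raises indices. -/

section Flat

variable {E : Type*} [NormedAddCommGroup E] [NormedSpace ℝ E]

/-- Christoffel symbols of the first kind:
`Γ(v, w; z) = ½ (∂_v G(w, z) + ∂_w G(v, z) - ∂_z G(v, w))`. -/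
def christoffelFirst (G : E → E →L[ℝ] E →L[ℝ] ℝ) (x : E) : E →L[ℝ] E →L[ℝ] E →L[ℝ] ℝ :=
  (1 / 2 : ℝ) • (fderiv ℝ G x + (fderiv ℝ G x).flip -
    ((ContinuousLinearMap.flipₗᵢ ℝ E E ℝ).toContinuousLinearEquiv :
      (E →L[ℝ] E →L[ℝ] ℝ) →L[ℝ] (E →L[ℝ] E →L[ℝ] ℝ)) ∘L (fderiv ℝ G x).flip)

theorem christoffelFirst_apply (G : E → E →L[ℝ] E →L[ℝ] ℝ) (x v w z : E) :
    christoffelFirst G x v w z =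
      (1 / 2 : ℝ) * (fderiv ℝ G x v w z + fderiv ℝ G x w v z - fderiv ℝ G x z v w) := by
  simp [christoffelFirst]

/-- Christoffel symbols of the second kind: `Γ(v, w)` is the vector with
`G(Γ(v, w), z) = Γ(v, w; z)`. -/
def christoffel (G : E → E →L[ℝ] E →L[ℝ] ℝ) (x : E) : E →L[ℝ] E →L[ℝ] E :=
  (ContinuousLinearMap.compL ℝ E (E →L[ℝ] ℝ) E (G x).inverse) ∘L christoffelFirst G x

/-- For fixed `v, w`, the endomorphism `z ↦ R(z, v) w`, where
`R(z, v) w = ∂_z Γ(v, w) - ∂_v Γ(z, w) + Γ(z, Γ(v, w)) - Γ(v, Γ(z, w))`. -/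
def curvatureEnd (G : E → E →L[ℝ] E →L[ℝ] ℝ) (x v w : E) : E →L[ℝ] E :=
  ((fderiv ℝ (christoffel G) x).flip v).flip w - (fderiv ℝ (christoffel G) x v).flip w
    + (christoffel G x).flip (christoffel G x v w)
    - (christoffel G x v) ∘L ((christoffel G x).flip w)

variable [FiniteDimensional ℝ E]

/-- The Ricci tensor `Ric(v, w) = tr (z ↦ R(z, v) w)` (positive on round spheres). -/
def ricciFlat (G : E → E →L[ℝ] E →L[ℝ] ℝ) (x : E) : E →L[ℝ] E →L[ℝ] ℝ :=
  LinearMap.toContinuousBilinearMap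
    (LinearMap.mk₂ ℝ (fun v w => LinearMap.trace ℝ E (curvatureEnd G x v w : E →ₗ[ℝ] E))
      (by
        intro v v' w
        rw [← map_add]; congr 1; ext z
        simp [curvatureEnd]; abel)
      (by
        intro c v w
        rw [← map_smul]; congr 1; ext z
        simp [curvatureEnd, smul_sub, smul_add])
      (by
        intro v w w'
        rw [← map_add]; congr 1; ext z
        simp [curvatureEnd]; abel)
      (by
        intro c v w
        rw [← map_smul]; congr 1; ext z
        simp [curvatureEnd, smul_sub, smul_add]))

end Flat

/-! ### Tensors on manifolds -/

section Manifold

variable {E : Type*} [NormedAddCommGroup E] [NormedSpace ℝ E]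
  {H : Type*} [TopologicalSpace H] (I : ModelWithCorners ℝ E H)
  {N : Type*} [TopologicalSpace N] [ChartedSpace H N]

/-- Coordinate expression, in the chart around `q`, of a one-form `α`. -/
def chartForm (α : ∀ p : N, TangentSpace I p →L[ℝ] ℝ) (q : N) (x : E) : E →L[ℝ] ℝ :=
  (α ((extChartAt I q).symm x)) ∘L (mfderiv 𝓘(ℝ, E) I (extChartAt I q).symm x)

/-- Coordinate expression, in the chart around `q`, of a field `B` of bilinear forms. -/
def chartBilin (B : ∀ p : N, TangentSpace I p →L[ℝ] TangentSpace I p →L[ℝ] ℝ) (q : N) (x : E) :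
    E →L[ℝ] E →L[ℝ] ℝ :=
  (ContinuousLinearMap.precomp ℝ (mfderiv 𝓘(ℝ, E) I (extChartAt I q).symm x)) ∘L
    (B ((extChartAt I q).symm x)) ∘L (mfderiv 𝓘(ℝ, E) I (extChartAt I q).symm x)

/-- The differential of a function at `p`, as a covector. -/
def dFun (f : N → ℝ) (p : N) : TangentSpace I p →L[ℝ] ℝ := mfderiv I 𝓘(ℝ, ℝ) f p

/-- The differential at `p` of the chart around `p`. -/
def chartDeriv (p : N) : TangentSpace I p →L[ℝ] E := mfderiv I 𝓘(ℝ, E) (extChartAt I p) p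

/-- The exterior derivative of a one-form at `p`:
`dα(v, w) = ∂_v α(w) - ∂_w α(v)` in the chart around `p`. -/
def extD (α : ∀ p : N, TangentSpace I p →L[ℝ] ℝ) (p : N) (v w : TangentSpace I p) : ℝ :=
  fderiv ℝ (chartForm I α p) (extChartAt I p p) (chartDeriv I p v) (chartDeriv I p w)
    - fderiv ℝ (chartForm I α p) (extChartAt I p p) (chartDeriv I p w) (chartDeriv I p v)

/-- The wedge product of two covectors. -/
def wedge {p : N} (α γ : TangentSpace I p →L[ℝ] ℝ) (v w : TangentSpace I p) : ℝ :=
  α v * γ w - α w * γ v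

/-- The tensor product of two covectors. -/
def tens {p : N} (α γ : TangentSpace I p →L[ℝ] ℝ) :
    TangentSpace I p →L[ℝ] TangentSpace I p →L[ℝ] ℝ :=
  α.smulRight γ

/-- The one-form `η` represents the zero class in first de Rham cohomology: it is the differential
of a globally defined smooth function. -/
def IsExactForm (η : ∀ p : N, TangentSpace I p →L[ℝ] ℝ) : Prop :=
  ∃ F : N → ℝ, ContMDiff I 𝓘(ℝ, ℝ) ∞ F ∧ ∀ p, dFun I F p = η p

/-- The vector `α^♯` dual to the covector `α` with respect to the metric `B` at `p`. -/
def sharp {p : N} (B : TangentSpace I p →L[ℝ] TangentSpace I p →L[ℝ] ℝ)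
    (α : TangentSpace I p →L[ℝ] ℝ) : TangentSpace I p :=
  B.inverse α

/-- The endomorphism `T^♯` with `B(T^♯ v, w) = T(v, w)`. -/
def raise {p : N} (B T : TangentSpace I p →L[ℝ] TangentSpace I p →L[ℝ] ℝ) :
    TangentSpace I p →ₗ[ℝ] TangentSpace I p :=
  (B.inverse ∘L T : TangentSpace I p →L[ℝ] TangentSpace I p)

/-- The trace `Tr_B T` of a bilinear form with respect to the metric `B` at `p`. -/
def metricTrace {p : N} (B T : TangentSpace I p →L[ℝ] TangentSpace I p →L[ℝ] ℝ) : ℝ :=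
  LinearMap.trace ℝ (TangentSpace I p) (raise I B T)

/-- The square norm `|T|²_B` (full contraction `T_{ij} T^{ij}`) of a symmetric bilinear form. -/
def metricNormSq {p : N} (B T : TangentSpace I p →L[ℝ] TangentSpace I p →L[ℝ] ℝ) : ℝ :=
  LinearMap.trace ℝ (TangentSpace I p) (raise I B T ∘ₗ raise I B T)

variable [FiniteDimensional ℝ E]

/-- The Ricci tensor at `p` of a pseudo-Riemannian metric `B`, computed in the chart
around `p`. -/
def ricci (B : ∀ p : N, TangentSpace I p →L[ℝ] TangentSpace I p →L[ℝ] ℝ) (p : N) :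
    TangentSpace I p →L[ℝ] TangentSpace I p →L[ℝ] ℝ :=
  (ContinuousLinearMap.precomp ℝ (chartDeriv I p)) ∘L
    (ricciFlat (chartBilin I B p) (extChartAt I p p)) ∘L (chartDeriv I p)

/-- The scalar curvature at `p` of a pseudo-Riemannian metric `B`. -/
def scalarCurvature (B : ∀ p : N, TangentSpace I p →L[ℝ] TangentSpace I p →L[ℝ] ℝ) (p : N) : ℝ :=
  metricTrace I (B p) (ricci I B p)

end Manifold

/-! ### Parallel spinor flows -/

section Flow

variable {S : Type*} [TopologicalSpace S] [ChartedSpace (EuclideanSpace ℝ (Fin 3)) S]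

/-- Model with corners of the space-time `ℝ × S`. -/
abbrev IM : ModelWithCorners ℝ (ℝ × EuclideanSpace ℝ (Fin 3))
    (ModelProd ℝ (EuclideanSpace ℝ (Fin 3))) :=
  𝓘(ℝ, ℝ).prod (𝓡 3)

/-- A time-dependent triple of one-forms `(e_u, e_l, e_n)` on `S`; `0, 1, 2` stand for
`u, l, n`. -/
abbrev FormTriple (S : Type*) [TopologicalSpace S] [ChartedSpace (EuclideanSpace ℝ (Fin 3)) S] :=
  ℝ → Fin 3 → ∀ p : S, TangentSpace (𝓡 3) p →L[ℝ] ℝ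

variable (β : ℝ → S → ℝ) (e : FormTriple S)

/-- The metric `h_t = e_u ⊗ e_u + e_l ⊗ e_l + e_n ⊗ e_n` on `S`. -/
def hMetric (t : ℝ) (p : S) :
    TangentSpace (𝓡 3) p →L[ℝ] TangentSpace (𝓡 3) p →L[ℝ] ℝ :=
  ∑ a, tens (𝓡 3) (e t a p) (e t a p)

/-- The curve `t ↦ h_t` of bilinear forms at a fixed point `p` of `S` (the tangent space at `p`
is the model space). -/
def hCurve (p : S) (t : ℝ) : EuclideanSpace ℝ (Fin 3) →L[ℝ] EuclideanSpace ℝ (Fin 3) →L[ℝ] ℝ :=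
  hMetric e t p

/-- The bilinear form `-(1 / (2 β_t)) ∂_t h_t` at a fixed point `p` of `S`. -/
def shapeModel (t : ℝ) (p : S) :
    EuclideanSpace ℝ (Fin 3) →L[ℝ] EuclideanSpace ℝ (Fin 3) →L[ℝ] ℝ :=
  (-(1 / (2 * β t p))) • deriv (hCurve e p) t

/-- The shape operator `Θ_t = -(1 / (2 β_t)) ∂_t h_t`. -/
def shape (t : ℝ) (p : S) :
    TangentSpace (𝓡 3) p →L[ℝ] TangentSpace (𝓡 3) p →L[ℝ] ℝ :=
  shapeModel β e t p

/-- The one-form `Θ_t(α) = Θ_t(α^♯, ·)` on `S`. -/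
def shapeForm (t : ℝ) (p : S) (α : TangentSpace (𝓡 3) p →L[ℝ] ℝ) :
    TangentSpace (𝓡 3) p →L[ℝ] ℝ :=
  shape β e t p (sharp (𝓡 3) (hMetric e t p) α)

/-- The function `dβ_t(α) = dβ_t(α^♯)`. -/
def dLapse (t : ℝ) (p : S) (α : TangentSpace (𝓡 3) p →L[ℝ] ℝ) : ℝ :=
  dFun (𝓡 3) (β t) p (sharp (𝓡 3) (hMetric e t p) α)

/-- A parallel spinor flow `{β_t, 𝔢^t}_{t ∈ J}` on `S`: smooth families of positive functions and
of coframes that satisfy the real parallel spinor flow equations. -/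
structure IsParallelSpinorFlow (J : Set ℝ) : Prop where
  lapse_smooth : ContMDiffOn IM 𝓘(ℝ, ℝ) ∞ (fun x : ℝ × S => β x.1 x.2) (J ×ˢ univ)
  lapse_pos : ∀ t ∈ J, ∀ p, 0 < β t p
  /-- In every chart, the components of each `e_a^t` are smooth functions of time and position. -/
  coframe_smooth : ∀ (a : Fin 3) (q : S),
    ContDiffOn ℝ ∞
      (fun y : ℝ × EuclideanSpace ℝ (Fin 3) => chartForm (𝓡 3) (e y.1 a) q y.2)
      (J ×ˢ (extChartAt (𝓡 3) q).target)
  coframe_indep : ∀ t ∈ J, ∀ p, LinearIndependent ℝ (fun a => e t a p)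
  /-- `∂_t e_a + dβ_t(e_a) e_u + β_t Θ_t(e_a) = δ_{au} dβ_t`. -/
  evolution : ∀ t ∈ J, ∀ p, ∀ a : Fin 3, ∀ v : TangentSpace (𝓡 3) p,
    deriv (fun s => e s a p v) t + dLapse β e t p (e t a p) * e t 0 p v
      + β t p * shapeForm β e t p (e t a p) v
      = if a = 0 then dFun (𝓡 3) (β t) p v else 0
  /-- `d e_a = Θ_t(e_a) ∧ e_u`. -/
  structure_eq : ∀ t ∈ J, ∀ p, ∀ a : Fin 3, ∀ v w : TangentSpace (𝓡 3) p,
    extD (𝓡 3) (e t a) p v w = wedge (𝓡 3) (shapeForm β e t p (e t a p)) (e t 0 p) v w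
  /-- `∂_t (Θ_t(e_u)) + d(dβ_t(e_u)) = 0`. -/
  shape_evolution : ∀ t ∈ J, ∀ p, ∀ v : TangentSpace (𝓡 3) p,
    deriv (fun s => shapeForm β e s p (e s 0 p) v) t
      + dFun (𝓡 3) (fun q => dLapse β e t q (e t 0 q)) p v = 0
  /-- `[Θ_t(e_u)] = 0` in `H¹(S, ℝ)`. -/
  exact : ∀ t ∈ J, IsExactForm (𝓡 3) (fun p => shapeForm β e t p (e t 0 p))

/-- A smooth family of functions `𝔣_t`, `t ∈ J`, with
`d𝔣_t = -Θ_t(e_u)` and `∂_t 𝔣_t = dβ_t(e_u)`. -/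
structure IsPotential (J : Set ℝ) (f : ℝ → S → ℝ) : Prop where
  smooth : ContMDiffOn IM 𝓘(ℝ, ℝ) ∞ (fun x : ℝ × S => f x.1 x.2) (J ×ˢ univ)
  space_deriv : ∀ t ∈ J, ∀ p, dFun (𝓡 3) (f t) p = -shapeForm β e t p (e t 0 p)
  time_deriv : ∀ t ∈ J, ∀ p, deriv (fun s => f s p) t = dLapse β e t p (e t 0 p)

/-- The one-form `dt` on `ℝ × S`. -/
def dTime (x : ℝ × S) : TangentSpace IM x →L[ℝ] ℝ := dFun IM (Prod.fst : ℝ × S → ℝ) x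

/-- The one-form `e_a^t` on `S`, regarded as a one-form on `ℝ × S`. -/
def spaceForm (a : Fin 3) (x : ℝ × S) : TangentSpace IM x →L[ℝ] ℝ :=
  (e x.1 a x.2) ∘L (mfderiv IM (𝓡 3) (Prod.snd : ℝ × S → S) x)

/-- The Lorentzian metric `g = -β_t² dt ⊗ dt + h_t` on `ℝ × S`. -/
def gMetric (x : ℝ × S) : TangentSpace IM x →L[ℝ] TangentSpace IM x →L[ℝ] ℝ :=
  -((β x.1 x.2) ^ 2 • tens IM (dTime x) (dTime x))
    + ∑ a, tens IM (spaceForm e a x) (spaceForm e a x)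

/-- The Dirac current `u = exp(𝔣_t) (β_t dt + e_u^t)`. -/
def diracCurrent (f : ℝ → S → ℝ) (x : ℝ × S) : TangentSpace IM x →L[ℝ] ℝ :=
  Real.exp (f x.1 x.2) • (β x.1 x.2 • dTime x + spaceForm e 0 x)

/-- The Hamiltonian function `R_{h_t} - |Θ_t|² + (Tr Θ_t)²`. -/
def hamiltonian (t : ℝ) (p : S) : ℝ :=
  scalarCurvature (𝓡 3) (hMetric e t) p
    - metricNormSq (𝓡 3) (hMetric e t p) (shape β e t p)
    + (metricTrace (𝓡 3) (hMetric e t p) (shape β e t p)) ^ 2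

end Flow

end SpinorFlow

end

/-! The proof is Cartan's moving frame method on the space-time. In a chart take the coframe `(β dt,
e_u, e_l, e_n)` and set `κ_a = Θ(e_a) - dβ(e_a) dt`. The evolution equations and `d e_a = Θ(e_a) ∧
e_u`, together with the symmetry of `Θ`, say that the matrix `timeConnection κ` satisfies the first
structure equation, so it is the Levi-Civita connection (`isCartanFrame_time`). This matrix
preserves the line of the null form `k = β dt + e_u`: its first two rows add up to `(κ_0, κ_0, 0,
0)`, hence `dk = κ_0 ∧ k`.

The remaining two equations give `dκ_0 = 0`. The curvature then has only null-rotation entries,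
built from `P_a = dκ_a + κ_0 ∧ κ_a` for `a = 1, 2`. The first Bianchi identity reads `P_a ∧ k = 0`
and `P_1 ∧ e_l + P_2 ∧ e_n = 0`. In the trace, the contributions of the directions `β dt` and `e_u`
cancel, and the other two are multiples of `k ⊗ k`. So `Ric = c k ⊗ k`, where `c` involves only
spatial derivatives of `Θ(e_l)`, `Θ(e_n)` and products of components of `Θ` (`ricciFlat_time`).

Each slice is treated in the same way with `spaceConnection`, which expresses `R_h` by the same
derivatives. Since `Tr(Θ)² - |Θ|²` is twice the sum of the principal 2-minors of `Θ`, comparison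
gives `c = H / 2` (`ricci_gMetric`). As `u = e^f k`, the stated formula follows.

The potential is a primitive of the closed form `-κ_0 = dβ(e_u) dt - Θ(e_u)`: start from a primitive
on one slice, which exists by exactness, and integrate in time (`exists_isPotential`). -/

noncomputable section

namespace SpinorFlow

/-! ### Dual frames -/

section DualFrame

variable {ι V : Type*} [Fintype ι] [AddCommGroup V] [Module ℝ V]
  [TopologicalSpace V]

section Forms

/-- The bilinear form `∑ ε i • α i ⊗ α i`. -/
def coframeForm (ε : ι → ℝ) (α : ι → V →L[ℝ] ℝ) :
    V →L[ℝ] V →L[ℝ] ℝ :=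
  ∑ i, ε i • (α i).smulRight (α i)

theorem coframeForm_apply (ε : ι → ℝ) (α : ι → V →L[ℝ] ℝ) (v w : V) :
    coframeForm ε α v w = ∑ i, ε i * (α i v * α i w) := by
  simp [coframeForm]

variable [IsTopologicalAddGroup V] [ContinuousSMul ℝ V]

/-- Evaluation of covectors at a vector. -/
def evalCovector (v : V) : (V →L[ℝ] ℝ) →L[ℝ] ℝ where
  toFun γ := γ v
  map_add' _ _ := rfl
  map_smul' _ _ := rfl
  cont := continuous_eval_const v

/-- The inverse of the metric `∑ ε i • α i ⊗ α i`. -/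
def coframeInverse (ε : ι → ℝ) (X : ι → V) : (V →L[ℝ] ℝ) →L[ℝ] V :=
  ∑ i, (evalCovector (X i)).smulRight (ε i • X i)

theorem coframeInverse_apply (ε : ι → ℝ) (X : ι → V) (γ : V →L[ℝ] ℝ) :
    coframeInverse ε X γ = ∑ i, (γ (X i) * ε i) • X i := by
  simp [coframeInverse, evalCovector, smul_smul]

end Forms

/-- The vectors `X i` form the frame dual to the coframe `α i`. -/
structure IsDualFrame [DecidableEq ι] (α : ι → V →L[ℝ] ℝ) (X : ι → V) : Prop where
  dual : ∀ i j, α i (X j) = if i = j then 1 else 0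
  complete : ∀ v, ∑ i, α i v • X i = v

variable {α : ι → V →L[ℝ] ℝ} {X : ι → V}

variable [DecidableEq ι]

theorem IsDualFrame.ext (h : IsDualFrame α X) {v w : V} (hvw : ∀ i, α i v = α i w) : v = w := by
  rw [← h.complete v, ← h.complete w]
  exact Finset.sum_congr rfl fun i _ => by rw [hvw]

theorem IsDualFrame.of_dual (h : IsDualFrame α X) {Y : ι → V}
    (hY : ∀ i j, α i (Y j) = if i = j then 1 else 0) : IsDualFrame α Y := by
  have : Y = X := funext fun j => h.ext fun i => by rw [hY, h.dual]
  rwa [this]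

theorem IsDualFrame.apply_eq_sum (h : IsDualFrame α X) (γ : V →L[ℝ] ℝ) (v : V) :
    γ v = ∑ i, γ (X i) * α i v := by
  conv_lhs => rw [← h.complete v]
  simp [mul_comm]

theorem IsDualFrame.trace_eq (h : IsDualFrame α X) [FiniteDimensional ℝ V] (T : V →ₗ[ℝ] V) :
    LinearMap.trace ℝ V T = ∑ i, α i (T (X i)) := by
  have hT : T = ∑ i, ((α i : V →ₗ[ℝ] ℝ) ∘ₗ T).smulRight (X i) := by
    ext v
    simp [LinearMap.sum_apply, h.complete]
  conv_lhs => rw [hT]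
  simp [LinearMap.trace_smulRight]

/-- By the dimension count the `α i` span the dual space, so a vector killed by all of them is zero.
Hence `v ↦ (α i v)` is bijective onto `ι → ℝ`, and the frame consists of the preimages of the
standard basis. -/
theorem exists_isDualFrame [FiniteDimensional ℝ V] (hα : LinearIndependent ℝ α)
    (hcard : Fintype.card ι = Module.finrank ℝ V) : ∃ X, IsDualFrame α X := by
  have hα' : LinearIndependent ℝ (fun i => ((α i : V →ₗ[ℝ] ℝ) : Module.Dual ℝ V)) :=
    hα.map' (ContinuousLinearMap.coeLM ℝ : (V →L[ℝ] ℝ) →ₗ[ℝ] (V →ₗ[ℝ] ℝ))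
      (LinearMap.ker_eq_bot.2 ContinuousLinearMap.coe_injective)
  have hspan := hα'.span_eq_top_of_card_eq_finrank' (by
    rw [hcard]; exact (Subspace.dual_finrank_eq (K := ℝ) (V := V)).symm)
  let T : V →ₗ[ℝ] (ι → ℝ) := LinearMap.pi fun i => (α i : V →ₗ[ℝ] ℝ)
  have hinj : Function.Injective T := by
    rw [← LinearMap.ker_eq_bot, LinearMap.ker_eq_bot']
    intro v hv
    rw [← Module.forall_dual_apply_eq_zero_iff ℝ v]
    intro φ
    have hφ : φ ∈ Submodule.span ℝ (range fun i => ((α i : V →ₗ[ℝ] ℝ) : Module.Dual ℝ V)) := by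
      rw [hspan]; trivial
    induction hφ using Submodule.span_induction with
    | mem x hx =>
      obtain ⟨i, rfl⟩ := hx
      exact congrFun hv i
    | zero => simp
    | add x y _ _ hx hy => simp [hx, hy]
    | smul a x _ hx => simp [hx]
  have hsurj : Function.Surjective T :=
    (LinearMap.injective_iff_surjective_of_finrank_eq_finrank (by simp [hcard])).1 hinj
  choose X hX using fun i : ι => hsurj (Pi.single i 1)
  have hdual : ∀ i j, α i (X j) = if i = j then 1 else 0 := fun i j => by
    have := congrFun (hX j) i
    simpa [T, Pi.single_apply] using this
  refine ⟨X, hdual, fun v => hinj ?_⟩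
  ext i
  simp [T, hdual]

variable [IsTopologicalAddGroup V] [ContinuousSMul ℝ V]

theorem IsDualFrame.coframeForm_comp_inverse (h : IsDualFrame α X) {ε : ι → ℝ}
    (hε : ∀ i, ε i * ε i = 1) :
    coframeForm ε α ∘L coframeInverse ε X = ContinuousLinearMap.id ℝ _ := by
  ext γ v
  simp only [ContinuousLinearMap.comp_apply, coframeForm_apply, ContinuousLinearMap.id_apply]
  rw [h.apply_eq_sum γ v]
  refine Finset.sum_congr rfl fun i _ => ?_
  simp only [coframeInverse_apply, map_sum, map_smul, h.dual]
  simp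
  linear_combination (γ (X i) * α i v) * hε i

theorem IsDualFrame.inverse_comp_coframeForm (h : IsDualFrame α X) {ε : ι → ℝ}
    (hε : ∀ i, ε i * ε i = 1) :
    coframeInverse ε X ∘L coframeForm ε α = ContinuousLinearMap.id ℝ _ := by
  ext v
  refine h.ext fun i => ?_
  simp [coframeInverse_apply, coframeForm_apply, h.dual]
  linear_combination (α i v) * hε i

theorem IsDualFrame.inverse_coframeForm (h : IsDualFrame α X) {ε : ι → ℝ}
    (hε : ∀ i, ε i * ε i = 1) : (coframeForm ε α).inverse = coframeInverse ε X :=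
  ContinuousLinearMap.inverse_eq (h.coframeForm_comp_inverse hε) (h.inverse_comp_coframeForm hε)

theorem IsDualFrame.isInvertible_coframeForm (h : IsDualFrame α X) {ε : ι → ℝ}
    (hε : ∀ i, ε i * ε i = 1) : (coframeForm ε α).IsInvertible :=
  .of_inverse (h.coframeForm_comp_inverse hε) (h.inverse_comp_coframeForm hε)

theorem IsDualFrame.apply_inverse_coframeForm (h : IsDualFrame α X) {ε : ι → ℝ}
    (hε : ∀ i, ε i * ε i = 1) (γ : V →L[ℝ] ℝ) (i : ι) :
    α i ((coframeForm ε α).inverse γ) = ε i * γ (X i) := by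
  simp [h.inverse_coframeForm hε, coframeInverse_apply, h.dual, mul_comm]

end DualFrame

/-! ### The Levi-Civita connection and the curvature of a metric given by a coframe -/

section Cartan

variable {ι V : Type*} [Fintype ι] [DecidableEq ι] [NormedAddCommGroup V] [NormedSpace ℝ V]

/-- A smooth coframe `θ` on the open set `U`, together with a matrix `A` of one-forms, skew with
respect to the signs `ε`, which satisfies Cartan's first structure equation
`dθ i = ∑ A i j ∧ θ j`. -/
structure IsCartanFrame (ε : ι → ℝ) (θ : ι → V → V →L[ℝ] ℝ) (A : ι → ι → V → V →L[ℝ] ℝ)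
    (U : Set V) : Prop where
  isOpen : IsOpen U
  sign : ∀ i, ε i * ε i = 1
  smooth : ∀ i, ContDiffOn ℝ ∞ (θ i) U
  conn_smooth : ∀ i j, ContDiffOn ℝ ∞ (A i j) U
  exists_dual : ∀ x ∈ U, ∃ X, IsDualFrame (fun i => θ i x) X
  skew : ∀ x ∈ U, ∀ i j v, ε i * A i j x v = -(ε j * A j i x v)
  torsion : ∀ x ∈ U, ∀ i v w, fderiv ℝ (θ i) x v w - fderiv ℝ (θ i) x w v =
    ∑ j, (A i j x v * θ j x w - A i j x w * θ j x v)

/-- The curvature forms `dA i k - ∑ A i j ∧ A j k`. -/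
def curvatureForm (A : ι → ι → V → V →L[ℝ] ℝ) (x : V) (i k : ι) (z v : V) : ℝ :=
  fderiv ℝ (A i k) x z v - fderiv ℝ (A i k) x v z
    - ∑ j, (A i j x z * A j k x v - A i j x v * A j k x z)

variable {ε : ι → ℝ} {θ : ι → V → V →L[ℝ] ℝ} {A : ι → ι → V → V →L[ℝ] ℝ} {U : Set V}
  {G : V → V →L[ℝ] V →L[ℝ] ℝ} {x : V}

namespace IsCartanFrame

theorem contDiffAt (h : IsCartanFrame ε θ A U) (hx : x ∈ U) (i : ι) : ContDiffAt ℝ ∞ (θ i) x :=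
  (h.smooth i).contDiffAt (h.isOpen.mem_nhds hx)

theorem hasFDerivAt (h : IsCartanFrame ε θ A U) (hx : x ∈ U) (i : ι) :
    HasFDerivAt (θ i) (fderiv ℝ (θ i) x) x :=
  ((h.contDiffAt hx i).differentiableAt (by simp)).hasFDerivAt

theorem conn_hasFDerivAt (h : IsCartanFrame ε θ A U) (hx : x ∈ U) (i j : ι) :
    HasFDerivAt (A i j) (fderiv ℝ (A i j) x) x :=
  (((h.conn_smooth i j).contDiffAt (h.isOpen.mem_nhds hx)).differentiableAt (by simp)).hasFDerivAt

theorem eventuallyEq (h : IsCartanFrame ε θ A U)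
    (hG : ∀ x ∈ U, G x = coframeForm ε fun i => θ i x) (hx : x ∈ U) :
    G =ᶠ[𝓝 x] fun x => coframeForm ε fun i => θ i x :=
  Filter.eventuallyEq_of_mem (h.isOpen.mem_nhds hx) hG

theorem contDiffOn_metric (h : IsCartanFrame ε θ A U)
    (hG : ∀ x ∈ U, G x = coframeForm ε fun i => θ i x) : ContDiffOn ℝ ∞ G U := by
  refine ContDiffOn.congr ?_ hG
  refine ContDiffOn.sum fun i _ => ContDiffOn.const_smul _ ?_
  exact (h.smooth i).smulRight (h.smooth i)

theorem fderiv_metric (h : IsCartanFrame ε θ A U)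
    (hG : ∀ x ∈ U, G x = coframeForm ε fun i => θ i x) (hx : x ∈ U) (v w z : V) :
    fderiv ℝ G x v w z =
      ∑ i, ε i * (fderiv ℝ (θ i) x v w * θ i x z + θ i x w * fderiv ℝ (θ i) x v z) := by
  have hGd : HasFDerivAt G (fderiv ℝ G x) x :=
    (((h.contDiffOn_metric hG).contDiffAt (h.isOpen.mem_nhds hx)).differentiableAt
      (by simp)).hasFDerivAt
  have h1 : HasFDerivAt (fun y => G y w z) (((fderiv ℝ G x).flip w).flip z) x := by
    simpa using (hGd.clm_apply (hasFDerivAt_const w x)).clm_apply (hasFDerivAt_const z x)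
  have hd : ∀ i w, HasFDerivAt (fun y => θ i y w) ((fderiv ℝ (θ i) x).flip w) x := fun i w => by
    simpa using (h.hasFDerivAt hx i).clm_apply (hasFDerivAt_const w x)
  have h2 : HasFDerivAt (fun y => (coframeForm ε fun i => θ i y) w z)
      (∑ i, ε i • (θ i x w • (fderiv ℝ (θ i) x).flip z + θ i x z • (fderiv ℝ (θ i) x).flip w))
      x := by
    simp only [coframeForm_apply]
    exact HasFDerivAt.fun_sum fun i _ => HasFDerivAt.const_mul ((hd i w).mul (hd i z)) _
  have h3 : HasFDerivAt (fun y => G y w z)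
      (∑ i, ε i • (θ i x w • (fderiv ℝ (θ i) x).flip z + θ i x z • (fderiv ℝ (θ i) x).flip w))
      x := by
    refine h2.congr_of_eventuallyEq ?_
    filter_upwards [h.eventuallyEq hG hx] with y hy
    rw [hy]
  have := congrArg (fun L => L v) (h1.unique h3)
  simp only [ContinuousLinearMap.flip_apply, sum_apply,
    smul_apply, add_apply, smul_eq_mul] at this
  rw [this]
  exact Finset.sum_congr rfl fun i _ => by ring

/-- Uniqueness of the Levi-Civita connection: the right-hand side `γ i` is symmetric because `A` has
no torsion, and compatible with the metric because `A` is skew. These two facts are all that the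
Koszul combination in `christoffelFirst` needs. -/
theorem apply_christoffel (h : IsCartanFrame ε θ A U)
    (hG : ∀ x ∈ U, G x = coframeForm ε fun i => θ i x) (hx : x ∈ U) (i : ι) (v w : V) :
    θ i x (christoffel G x v w) = fderiv ℝ (θ i) x v w - ∑ j, A i j x v * θ j x w := by
  obtain ⟨X, hX⟩ := h.exists_dual x hx
  set γ : ι → V → V → ℝ := fun i v w => fderiv ℝ (θ i) x v w - ∑ j, A i j x v * θ j x w with hγ
  have hsymm : ∀ i v w, γ i v w = γ i w v := fun i v w => by
    have := h.torsion x hx i v w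
    rw [Finset.sum_sub_distrib] at this
    simp only [hγ]
    linarith
  have hD : ∀ v w z, fderiv ℝ G x v w z =
      ∑ i, (ε i * γ i v w * θ i x z + ε i * γ i v z * θ i x w) := fun v w z => by
    -- Skewness makes the connection terms cancel, so `fderiv ℝ (θ i) x v` may be replaced by `γ i
    -- v` in the derivative of the metric.
    have hskew : ∑ i, ∑ j, (ε i * A i j x v) * (θ j x w * θ i x z) =
        -∑ i, ∑ j, (ε i * A i j x v) * (θ j x z * θ i x w) := by
      rw [Finset.sum_comm, ← Finset.sum_neg_distrib]
      refine Finset.sum_congr rfl fun i _ => ?_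
      rw [← Finset.sum_neg_distrib]
      refine Finset.sum_congr rfl fun j _ => ?_
      rw [h.skew x hx j i v]
      ring
    rw [h.fderiv_metric hG hx, ← sub_eq_zero, ← Finset.sum_sub_distrib]
    rw [← eq_neg_iff_add_eq_zero.1 hskew, ← Finset.sum_add_distrib]
    refine Finset.sum_congr rfl fun i _ => ?_
    rw [← Finset.sum_add_distrib]
    have : ∑ j, (ε i * A i j x v * (θ j x w * θ i x z) + ε i * A i j x v * (θ j x z * θ i x w)) =
        ε i * (∑ j, A i j x v * θ j x w) * θ i x z
          + ε i * (∑ j, A i j x v * θ j x z) * θ i x w := by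
      simp only [Finset.mul_sum, Finset.sum_mul, ← Finset.sum_add_distrib]
      exact Finset.sum_congr rfl fun j _ => by ring
    rw [this]
    simp only [hγ]
    ring
  have hfirst : ∀ z, christoffelFirst G x v w z = ∑ i, ε i * γ i v w * θ i x z := fun z => by
    rw [christoffelFirst_apply, hD, hD, hD, ← Finset.sum_add_distrib, ← Finset.sum_sub_distrib,
      Finset.mul_sum]
    refine Finset.sum_congr rfl fun i _ => ?_
    rw [hsymm i w v, hsymm i z v, hsymm i z w]
    ring
  have : christoffel G x v w = (coframeForm ε fun i => θ i x).inverse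
      (christoffelFirst G x v w) := by
    simp [christoffel, hG x hx]
  rw [this, hX.apply_inverse_coframeForm h.sign, hfirst]
  simp [hX.dual]
  linear_combination (γ i v w) * h.sign i

theorem christoffel_symm (h : IsCartanFrame ε θ A U)
    (hG : ∀ x ∈ U, G x = coframeForm ε fun i => θ i x) (hx : x ∈ U) (v w : V) :
    christoffel G x v w = christoffel G x w v := by
  obtain ⟨X, hX⟩ := h.exists_dual x hx
  refine hX.ext fun i => ?_
  have := h.torsion x hx i v w
  rw [Finset.sum_sub_distrib] at this
  rw [h.apply_christoffel hG hx, h.apply_christoffel hG hx]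
  linarith

theorem hasFDerivAt_christoffel [CompleteSpace V] (h : IsCartanFrame ε θ A U)
    (hG : ∀ x ∈ U, G x = coframeForm ε fun i => θ i x) (hx : x ∈ U) :
    HasFDerivAt (christoffel G) (fderiv ℝ (christoffel G) x) x := by
  obtain ⟨X, hX⟩ := h.exists_dual x hx
  have hGx : ContDiffAt ℝ ∞ G x := (h.contDiffOn_metric hG).contDiffAt (h.isOpen.mem_nhds hx)
  have hinv : ContDiffAt ℝ ∞ (fun y => (G y).inverse) x := by
    have : (G x).IsInvertible := by
      rw [hG x hx]
      exact hX.isInvertible_coframeForm h.sign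
    exact this.contDiffAt_map_inverse.comp x hGx
  have hdG : ContDiffAt ℝ ∞ (fderiv ℝ G) x := hGx.fderiv_right (by simp)
  have hflip : ContDiffAt ℝ ∞ (fun y => (fderiv ℝ G y).flip) x :=
    (ContinuousLinearMap.flipₗᵢ ℝ V V (V →L[ℝ] ℝ)).toContinuousLinearEquiv.contDiff.contDiffAt.comp
      x hdG
  have hflip' : ContDiffAt ℝ ∞ (fun y =>
      ((ContinuousLinearMap.flipₗᵢ ℝ V V ℝ).toContinuousLinearEquiv :
        (V →L[ℝ] V →L[ℝ] ℝ) →L[ℝ] (V →L[ℝ] V →L[ℝ] ℝ)) ∘L (fderiv ℝ G y).flip) x :=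
    contDiffAt_const.clm_comp hflip
  have hfirst : ContDiffAt ℝ ∞ (christoffelFirst G) x :=
    ((hdG.add hflip).sub hflip').const_smul (1 / 2 : ℝ)
  have : ContDiffAt ℝ ∞ (christoffel G) x :=
    ((ContinuousLinearMap.compL ℝ V (V →L[ℝ] ℝ) V).contDiff.contDiffAt.comp x hinv).clm_comp hfirst
  exact (this.differentiableAt (by simp)).hasFDerivAt

/-- Cartan's second structure equation. Differentiate the formula for `θ i (Γ(v, w))` along `z` and
antisymmetrise in `z, v`. The minus sign comes from the convention `dθ = A ∧ θ`. -/
theorem apply_curvatureEnd [CompleteSpace V] (h : IsCartanFrame ε θ A U)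
    (hG : ∀ x ∈ U, G x = coframeForm ε fun i => θ i x) (hx : x ∈ U) (i : ι) (z v w : V) :
    θ i x (curvatureEnd G x v w z) = -∑ k, curvatureForm A x i k z v * θ k x w := by
  have hΓ := h.hasFDerivAt_christoffel hG hx
  -- On the right, the second derivative of `θ i` and the bracketed sum are symmetric in `z, v`;
  -- only the `dA` and `A A` terms survive antisymmetrisation.
  have key : ∀ z v, θ i x (fderiv ℝ (christoffel G) x z v w)
      + θ i x (christoffel G x z (christoffel G x v w)) = fderiv ℝ (fderiv ℝ (θ i)) x z v w
        - ∑ j, fderiv ℝ (A i j) x z v * θ j x w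
        - (∑ j, (A i j x v * fderiv ℝ (θ j) x z w + A i j x z * fderiv ℝ (θ j) x v w))
        + ∑ k, (∑ j, A i j x z * A j k x v) * θ k x w := by
    intro z v
    have h1 : HasFDerivAt (fun y => christoffel G y v w)
        (((fderiv ℝ (christoffel G) x).flip v).flip w) x := by
      simpa using (hΓ.clm_apply (hasFDerivAt_const v x)).clm_apply (hasFDerivAt_const w x)
    have h2 := (h.hasFDerivAt hx i).clm_apply h1
    have hd : ∀ j, HasFDerivAt (fun y => θ j y w) ((fderiv ℝ (θ j) x).flip w) x := fun j => by
      simpa using (h.hasFDerivAt hx j).clm_apply (hasFDerivAt_const w x)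
    have hA : ∀ j, HasFDerivAt (fun y => A i j y v) ((fderiv ℝ (A i j) x).flip v) x := fun j => by
      simpa using (h.conn_hasFDerivAt hx i j).clm_apply (hasFDerivAt_const v x)
    have hdd : HasFDerivAt (fderiv ℝ (θ i)) (fderiv ℝ (fderiv ℝ (θ i)) x) x :=
      (((h.contDiffAt hx i).fderiv_right (m := ∞) (by simp)).differentiableAt (by simp)).hasFDerivAt
    have hdd' : HasFDerivAt (fun y => fderiv ℝ (θ i) y v w)
        (((fderiv ℝ (fderiv ℝ (θ i)) x).flip v).flip w) x := by
      simpa using (hdd.clm_apply (hasFDerivAt_const v x)).clm_apply (hasFDerivAt_const w x)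
    have h3 := hdd'.sub (HasFDerivAt.fun_sum fun j (_ : j ∈ Finset.univ) => (hA j).mul (hd j))
    have h4 := h3.congr_of_eventuallyEq (f₁ := fun y => θ i y (christoffel G y v w)) (by
      filter_upwards [h.isOpen.mem_nhds hx] with y hy
      exact h.apply_christoffel hG hy i v w)
    have h5 := congrArg (fun L => L z) (h2.unique h4)
    simp only [ContinuousLinearMap.flip_apply, sum_apply, ContinuousLinearMap.comp_apply,
      smul_apply, add_apply, smul_eq_mul,
      sub_apply] at h5
    rw [h.apply_christoffel hG hx i z (christoffel G x v w)]
    simp only [h.apply_christoffel hG hx _ v w]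
    have h6 : ∑ k, (∑ j, A i j x z * A j k x v) * θ k x w =
        ∑ j, A i j x z * ∑ k, A j k x v * θ k x w := by
      simp only [Finset.sum_mul, Finset.mul_sum]
      rw [Finset.sum_comm]
      exact Finset.sum_congr rfl fun j _ => Finset.sum_congr rfl fun k _ => by ring
    rw [h6]
    simp only [Finset.sum_add_distrib, mul_sub, Finset.sum_sub_distrib] at h5 ⊢
    have h7 : ∑ j, θ j x w * fderiv ℝ (A i j) x z v = ∑ j, fderiv ℝ (A i j) x z v * θ j x w :=
      Finset.sum_congr rfl fun j _ => mul_comm _ _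
    linarith
  have hsymm : fderiv ℝ (fderiv ℝ (θ i)) x z v w = fderiv ℝ (fderiv ℝ (θ i)) x v z w := by
    rw [(h.contDiffAt hx i).isSymmSndFDerivAt
      (by simp; exact WithTop.coe_le_coe.2 (le_top : (2 : ℕ∞) ≤ ⊤)) z v]
  have h1 := key z v
  have h2 := key v z
  have h3 : curvatureEnd G x v w z = fderiv ℝ (christoffel G) x z v w
      - fderiv ℝ (christoffel G) x v z w + christoffel G x z (christoffel G x v w)
      - christoffel G x v (christoffel G x z w) := by
    simp [curvatureEnd]
  rw [h3]
  simp only [map_sub, map_add, curvatureForm, sub_mul, Finset.sum_sub_distrib,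
    Finset.sum_add_distrib] at h1 h2 ⊢
  linarith

/-- The first Bianchi identity `F ∧ θ = 0`. The cyclic sum of the curvature endomorphisms vanishes
because the Christoffel symbols, hence also their derivatives, are symmetric; applying `θ i` turns
this into an identity for the curvature forms. -/
theorem curvatureForm_bianchi [CompleteSpace V] (h : IsCartanFrame ε θ A U)
    (hG : ∀ x ∈ U, G x = coframeForm ε fun i => θ i x) (hx : x ∈ U) (i : ι) (z v w : V) :
    ∑ k, (curvatureForm A x i k z v * θ k x w + curvatureForm A x i k v w * θ k x z
      + curvatureForm A x i k w z * θ k x v) = 0 := by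
  have hsymm : ∀ u v w, fderiv ℝ (christoffel G) x u v w = fderiv ℝ (christoffel G) x u w v := by
    intro u v w
    have hΓ := h.hasFDerivAt_christoffel hG hx
    have h1 : ∀ v w, HasFDerivAt (fun y => christoffel G y v w)
        (((fderiv ℝ (christoffel G) x).flip v).flip w) x := fun v w => by
      simpa using (hΓ.clm_apply (hasFDerivAt_const v x)).clm_apply (hasFDerivAt_const w x)
    have h2 := (h1 v w).congr_of_eventuallyEq (f₁ := fun y => christoffel G y w v) (by
      filter_upwards [h.isOpen.mem_nhds hx] with y hy
      exact h.christoffel_symm hG hy w v)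
    exact congrArg (fun L => L u) (h2.unique (h1 w v))
  have hsum : curvatureEnd G x v w z + curvatureEnd G x w z v + curvatureEnd G x z v w = 0 := by
    simp only [curvatureEnd, sub_apply, add_apply,
      ContinuousLinearMap.flip_apply, ContinuousLinearMap.comp_apply]
    rw [hsymm z v w, hsymm v w z, hsymm w z v, h.christoffel_symm hG hx v w,
      h.christoffel_symm hG hx w z, h.christoffel_symm hG hx z v]
    abel
  have := congrArg (θ i x) hsum
  simp only [map_add, h.apply_curvatureEnd hG hx, map_zero] at this
  simp only [Finset.sum_add_distrib]
  linarith

theorem ricciFlat_eq [FiniteDimensional ℝ V] (h : IsCartanFrame ε θ A U)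
    (hG : ∀ x ∈ U, G x = coframeForm ε fun i => θ i x) (hx : x ∈ U) {X : ι → V}
    (hX : IsDualFrame (fun i => θ i x) X) (v w : V) :
    ricciFlat G x v w = -∑ i, ∑ k, curvatureForm A x i k (X i) v * θ k x w := by
  have : CompleteSpace V := FiniteDimensional.complete ℝ V
  have : ricciFlat G x v w =
      LinearMap.trace ℝ V (curvatureEnd G x v w : V →ₗ[ℝ] V) := rfl
  rw [this, hX.trace_eq, ← Finset.sum_neg_distrib]
  exact Finset.sum_congr rfl fun i _ => h.apply_curvatureEnd hG hx i (X i) v w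

end IsCartanFrame

end Cartan

/-! ### Parallel spinor flows in a coordinate domain -/

section CoordinateFlow

variable {E : Type*} [NormedAddCommGroup E] [NormedSpace ℝ E]

/-- A parallel spinor flow in coordinates: on the open set `U` of `ℝ × E` we are given the lapse
`b`, the coframe `ε a`, the one-forms `ψ a = Θ(ε a)`, and the derivatives `l a = db(ε a)`. -/
structure IsCoordinateFlow (b : ℝ × E → ℝ) (ε ψ : Fin 3 → ℝ × E → E →L[ℝ] ℝ)
    (l : Fin 3 → ℝ × E → ℝ) (U : Set (ℝ × E)) : Prop where
  isOpen : IsOpen U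
  lapse_smooth : ContDiffOn ℝ ∞ b U
  coframe_smooth : ∀ a, ContDiffOn ℝ ∞ (ε a) U
  shape_smooth : ∀ a, ContDiffOn ℝ ∞ (ψ a) U
  dlapse_smooth : ∀ a, ContDiffOn ℝ ∞ (l a) U
  lapse_pos : ∀ y ∈ U, 0 < b y
  exists_dual : ∀ y ∈ U, ∃ X, IsDualFrame (fun a => ε a y) X
  shape_symm : ∀ y ∈ U, ∀ v w, ∑ a, ψ a y v * ε a y w = ∑ a, ψ a y w * ε a y v
  dlapse : ∀ y ∈ U, ∀ v, fderiv ℝ b y (0, v) = ∑ a, l a y * ε a y v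
  evolution : ∀ y ∈ U, ∀ a v, fderiv ℝ (ε a) y (1, 0) v + l a y * ε 0 y v + b y * ψ a y v =
    if a = 0 then fderiv ℝ b y (0, v) else 0
  structure_eq : ∀ y ∈ U, ∀ a v w, fderiv ℝ (ε a) y (0, v) w - fderiv ℝ (ε a) y (0, w) v =
    ψ a y v * ε 0 y w - ψ a y w * ε 0 y v
  closed : ∀ y ∈ U, ∀ v w, fderiv ℝ (ψ 0) y (0, v) w = fderiv ℝ (ψ 0) y (0, w) v
  shape_evolution : ∀ y ∈ U, ∀ v, fderiv ℝ (ψ 0) y (1, 0) v + fderiv ℝ (l 0) y (0, v) = 0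

/-- The coframe `(b dt, ε 0, ε 1, ε 2)` of the space-time. -/
def timeCoframe (b : ℝ × E → ℝ) (ε : Fin 3 → ℝ × E → E →L[ℝ] ℝ) :
    Fin 4 → ℝ × E → ℝ × E →L[ℝ] ℝ :=
  Fin.cons (fun y => b y • ContinuousLinearMap.fst ℝ ℝ E)
    fun a y => ε a y ∘L ContinuousLinearMap.snd ℝ ℝ E

/-- The one-forms `κ a = ψ a - l a dt`. -/
def connectionForm (ψ : Fin 3 → ℝ × E → E →L[ℝ] ℝ) (l : Fin 3 → ℝ × E → ℝ) (a : Fin 3)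
    (y : ℝ × E) : ℝ × E →L[ℝ] ℝ :=
  ψ a y ∘L ContinuousLinearMap.snd ℝ ℝ E - l a y • ContinuousLinearMap.fst ℝ ℝ E

/-- The connection matrix of the space-time coframe, in terms of three one-forms. -/
def timeConnection {V : Type*} [NormedAddCommGroup V] [NormedSpace ℝ V]
    (κ : Fin 3 → V → V →L[ℝ] ℝ) : Fin 4 → Fin 4 → V → V →L[ℝ] ℝ :=
  ![![0, κ 0, κ 1, κ 2], ![κ 0, 0, -κ 1, -κ 2], ![κ 1, κ 1, 0, 0], ![κ 2, κ 2, 0, 0]]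

/-- The connection matrix of the spatial coframe. -/
def spaceConnection {V : Type*} [NormedAddCommGroup V] [NormedSpace ℝ V]
    (κ : Fin 3 → V → V →L[ℝ] ℝ) : Fin 3 → Fin 3 → V → V →L[ℝ] ℝ :=
  ![![0, -κ 1, -κ 2], ![κ 1, 0, 0], ![κ 2, 0, 0]]

variable {b : ℝ × E → ℝ} {ε ψ : Fin 3 → ℝ × E → E →L[ℝ] ℝ} {l : Fin 3 → ℝ × E → ℝ}
  {U : Set (ℝ × E)} {y : ℝ × E}

/-! ### Derivatives of the space-time forms and time-space splitting -/

theorem fderiv_connectionForm (hψ : ∀ a, DifferentiableAt ℝ (ψ a) y)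
    (hl : ∀ a, DifferentiableAt ℝ (l a) y) (a : Fin 3) (v w : ℝ × E) :
    fderiv ℝ (connectionForm ψ l a) y v w =
      fderiv ℝ (ψ a) y v w.2 - fderiv ℝ (l a) y v * w.1 := by
  have h := ((hψ a).hasFDerivAt.clm_comp
    (hasFDerivAt_const (ContinuousLinearMap.snd ℝ ℝ E) y)).sub
    ((hl a).hasFDerivAt.smul_const (ContinuousLinearMap.fst ℝ ℝ E))
  have h' : fderiv ℝ (connectionForm ψ l a) y = _ := h.fderiv
  rw [h']
  simp

theorem fderiv_timeCoframe_zero (hb : DifferentiableAt ℝ b y) (v w : ℝ × E) :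
    fderiv ℝ (timeCoframe b ε 0) y v w = fderiv ℝ b y v * w.1 := by
  have h := hb.hasFDerivAt.smul_const (ContinuousLinearMap.fst ℝ ℝ E)
  have h' : fderiv ℝ (timeCoframe b ε 0) y = _ := h.fderiv
  rw [h']
  simp

theorem fderiv_timeCoframe_succ (hε : ∀ a, DifferentiableAt ℝ (ε a) y) (a : Fin 3)
    (v w : ℝ × E) :
    fderiv ℝ (timeCoframe b ε a.succ) y v w = fderiv ℝ (ε a) y v w.2 := by
  have h := (hε a).hasFDerivAt.clm_comp (hasFDerivAt_const (ContinuousLinearMap.snd ℝ ℝ E) y)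
  have h' : fderiv ℝ (timeCoframe b ε a.succ) y = _ := h.fderiv
  rw [h']
  simp

theorem timeCoframe_zero_apply (v : ℝ × E) : timeCoframe b ε 0 y v = b y * v.1 := by
  simp [timeCoframe]

theorem timeCoframe_succ_apply (a : Fin 3) (v : ℝ × E) :
    timeCoframe b ε a.succ y v = ε a y v.2 := by
  simp [timeCoframe]

theorem connectionForm_apply (a : Fin 3) (v : ℝ × E) :
    connectionForm ψ l a y v = ψ a y v.2 - l a y * v.1 := by
  simp [connectionForm]

/-- A linear map on `ℝ × E` is determined by its time and space parts. -/
theorem apply_eq_time_add_space {F : Type*} [NormedAddCommGroup F] [NormedSpace ℝ F]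
    (L : ℝ × E →L[ℝ] F) (v : ℝ × E) : L v = v.1 • L (1, 0) + L (0, v.2) := by
  rw [← map_smul, ← map_add]
  simp

theorem hasFDerivAt_slice {F : Type*} [NormedAddCommGroup F] [NormedSpace ℝ F] {f : ℝ × E → F}
    {t : ℝ} {x : E} (hf : DifferentiableAt ℝ f (t, x)) :
    HasFDerivAt (fun x => f (t, x)) (fderiv ℝ f (t, x) ∘L ContinuousLinearMap.inr ℝ ℝ E) x :=
  hf.hasFDerivAt.comp x (hasFDerivAt_prodMk_right t x)

theorem hasDerivAt_time {F : Type*} [NormedAddCommGroup F] [NormedSpace ℝ F] {f : ℝ × E → F}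
    {t : ℝ} {x : E} (hf : DifferentiableAt ℝ f (t, x)) :
    HasDerivAt (fun s => f (s, x)) (fderiv ℝ f (t, x) (1, 0)) t := by
  have h1 : HasFDerivAt (fun s => f (s, x)) _ t :=
    hf.hasFDerivAt.comp t (hasFDerivAt_prodMk_left t x)
  simpa using h1.hasDerivAt

/-- The frame dual to the space-time coframe. -/
def timeFrame (c : ℝ) (X : Fin 3 → E) : Fin 4 → ℝ × E :=
  Fin.cons (c⁻¹, 0) fun a => (0, X a)

theorem isDualFrame_timeFrame (hb : b y ≠ 0) {X : Fin 3 → E}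
    (hX : IsDualFrame (fun a => ε a y) X) :
    IsDualFrame (fun i => timeCoframe b ε i y) (timeFrame (b y) X) where
  dual i j := by
    refine Fin.cases ?_ (fun i => ?_) i <;> refine Fin.cases ?_ (fun j => ?_) j
    · simp [timeCoframe_zero_apply, timeFrame, hb]
    · simp [timeCoframe_zero_apply, timeFrame, (Fin.succ_ne_zero j).symm]
    · simp [timeCoframe_succ_apply, timeFrame]
    · simp [timeCoframe_succ_apply, timeFrame, hX.dual]
  complete v := by
    rw [Fin.sum_univ_succ]
    simp only [timeCoframe_zero_apply, timeCoframe_succ_apply, timeFrame, Fin.cons_zero,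
      Fin.cons_succ]
    ext
    · simp [Prod.fst_sum]
      field_simp
    · simp [Prod.snd_sum, hX.complete v.2]

/-! ### Structure equations and curvature of a coordinate flow -/

namespace IsCoordinateFlow

theorem differentiableAt_lapse (h : IsCoordinateFlow b ε ψ l U) (hy : y ∈ U) :
    DifferentiableAt ℝ b y :=
  (h.lapse_smooth.contDiffAt (h.isOpen.mem_nhds hy)).differentiableAt (by simp)

theorem differentiableAt_coframe (h : IsCoordinateFlow b ε ψ l U) (hy : y ∈ U) (a : Fin 3) :
    DifferentiableAt ℝ (ε a) y :=
  ((h.coframe_smooth a).contDiffAt (h.isOpen.mem_nhds hy)).differentiableAt (by simp)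

theorem differentiableAt_shape (h : IsCoordinateFlow b ε ψ l U) (hy : y ∈ U) (a : Fin 3) :
    DifferentiableAt ℝ (ψ a) y :=
  ((h.shape_smooth a).contDiffAt (h.isOpen.mem_nhds hy)).differentiableAt (by simp)

theorem differentiableAt_dlapse (h : IsCoordinateFlow b ε ψ l U) (hy : y ∈ U) (a : Fin 3) :
    DifferentiableAt ℝ (l a) y :=
  ((h.dlapse_smooth a).contDiffAt (h.isOpen.mem_nhds hy)).differentiableAt (by simp)

theorem contDiffOn_timeCoframe (h : IsCoordinateFlow b ε ψ l U) (i : Fin 4) :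
    ContDiffOn ℝ ∞ (timeCoframe b ε i) U := by
  refine Fin.cases ?_ (fun a => ?_) i
  · exact h.lapse_smooth.smul contDiffOn_const
  · exact (h.coframe_smooth a).clm_comp contDiffOn_const

theorem contDiffOn_connectionForm (h : IsCoordinateFlow b ε ψ l U) (a : Fin 3) :
    ContDiffOn ℝ ∞ (connectionForm ψ l a) U :=
  ((h.shape_smooth a).clm_comp contDiffOn_const).sub
    ((h.dlapse_smooth a).smul contDiffOn_const)

/-- The flow equations are the first structure equation of the space-time: their space-space part is
`structure_eq`, their time-space part is `evolution`. Symmetry of the shape operator, `∑ ψ a ∧ ε a =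
0`, is what allows the matrix to be skew with respect to the signs. -/
theorem isCartanFrame_time (h : IsCoordinateFlow b ε ψ l U) :
    IsCartanFrame ![-1, 1, 1, 1] (timeCoframe b ε) (timeConnection (connectionForm ψ l)) U where
  isOpen := h.isOpen
  sign i := by fin_cases i <;> simp
  smooth := h.contDiffOn_timeCoframe
  conn_smooth i j := by
    have h0 : ContDiffOn ℝ ∞ (0 : ℝ × E → ℝ × E →L[ℝ] ℝ) U := contDiffOn_const
    have hκ := h.contDiffOn_connectionForm
    have hκ' := fun a => (hκ a).neg
    fin_cases i <;> fin_cases j <;> first | exact h0 | exact hκ _ | exact hκ' _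
  exists_dual y hy := by
    obtain ⟨X, hX⟩ := h.exists_dual y hy
    exact ⟨_, isDualFrame_timeFrame (h.lapse_pos y hy).ne' hX⟩
  skew y hy i j v := by
    fin_cases i <;> fin_cases j <;> simp [timeConnection]
  torsion y hy i v w := by
    have hsymm := h.shape_symm y hy v.2 w.2
    have hlv := h.dlapse y hy v.2
    have hlw := h.dlapse y hy w.2
    simp only [Fin.sum_univ_three] at hsymm hlv hlw
    refine Fin.cases ?_ (fun a => ?_) i
    · rw [fderiv_timeCoframe_zero (h.differentiableAt_lapse hy),
        fderiv_timeCoframe_zero (h.differentiableAt_lapse hy),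
        apply_eq_time_add_space (fderiv ℝ b y) v, apply_eq_time_add_space (fderiv ℝ b y) w,
        hlv, hlw, Fin.sum_univ_succ, Fin.sum_univ_three]
      simp only [timeCoframe_zero_apply, timeCoframe_succ_apply]
      simp [timeConnection, connectionForm_apply]
      -- Here `d(b dt) = db ∧ dt` must equal `∑ κ a ∧ ε a`; the `dt` terms agree by `dlapse`, and `∑
      -- ψ a ∧ ε a` vanishes.
      linear_combination -hsymm
    · rw [fderiv_timeCoframe_succ (h.differentiableAt_coframe hy),
        fderiv_timeCoframe_succ (h.differentiableAt_coframe hy),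
        apply_eq_time_add_space (fderiv ℝ (ε a) y) v,
        apply_eq_time_add_space (fderiv ℝ (ε a) y) w, Fin.sum_univ_succ, Fin.sum_univ_three]
      have hev := h.evolution y hy a v.2
      have hew := h.evolution y hy a w.2
      have hst := h.structure_eq y hy a v.2 w.2
      simp only [timeCoframe_zero_apply, timeCoframe_succ_apply]
      fin_cases a
      · simp [timeConnection, connectionForm_apply] at *
        -- For `e_u` the source `dβ` in the evolution equation is expanded in the coframe, and `ψ 0
        -- ∧ ε 0` is traded for `-(ψ 1 ∧ ε 1 + ψ 2 ∧ ε 2)`.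
        linear_combination v.1 * hew - w.1 * hev + hst + v.1 * hlw - w.1 * hlv + hsymm
      · simp [timeConnection, connectionForm_apply] at *
        linear_combination v.1 * hew - w.1 * hev + hst
      · simp [timeConnection, connectionForm_apply] at *
        linear_combination v.1 * hew - w.1 * hev + hst

/-- The equation `d e_u = Θ(e_u) ∧ e_u` does not have skew form, but by symmetry of `Θ` its right
side equals `-(ψ 1 ∧ ε 1 + ψ 2 ∧ ε 2)`. This is why `ψ 0` is absent from the matrix. -/
theorem isCartanFrame_slice (h : IsCoordinateFlow b ε ψ l U) (t : ℝ) :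
    IsCartanFrame 1 (fun a x => ε a (t, x)) (spaceConnection fun a x => ψ a (t, x))
      {x | (t, x) ∈ U} where
  isOpen := h.isOpen.preimage (Continuous.prodMk_right t)
  sign i := by simp
  smooth a := (h.coframe_smooth a).comp (contDiff_prodMk_right t).contDiffOn fun _ hx => hx
  conn_smooth i j := by
    have h0 : ContDiffOn ℝ ∞ (0 : E → E →L[ℝ] ℝ) {x | (t, x) ∈ U} := contDiffOn_const
    have hκ : ∀ a, ContDiffOn ℝ ∞ (fun x => ψ a (t, x)) {x | (t, x) ∈ U} := fun a =>
      (h.shape_smooth a).comp (contDiff_prodMk_right t).contDiffOn fun _ hx => hx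
    have hκ' := fun a => (hκ a).neg
    fin_cases i <;> fin_cases j <;> first | exact h0 | exact hκ _ | exact hκ' _
  exists_dual x hx := h.exists_dual (t, x) hx
  skew x hx i j v := by
    fin_cases i <;> fin_cases j <;> simp [spaceConnection]
  torsion x hx a v w := by
    have hsymm := h.shape_symm _ hx v w
    have hst := h.structure_eq _ hx a v w
    rw [(hasFDerivAt_slice (h.differentiableAt_coframe hx a)).fderiv]
    simp only [Fin.sum_univ_three, ContinuousLinearMap.comp_apply,
      ContinuousLinearMap.inr_apply] at hsymm ⊢
    rw [hst]
    fin_cases a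
    · simp [spaceConnection]
      linear_combination hsymm
    · simp [spaceConnection]
    · simp [spaceConnection]

/-- Sum over a dual frame of the diagonal Ricci curvatures of a time slice. -/
theorem sum_ricciFlat_slice [FiniteDimensional ℝ E] (h : IsCoordinateFlow b ε ψ l U) {t : ℝ}
    {x : E} (hx : (t, x) ∈ U) {H : E → E →L[ℝ] E →L[ℝ] ℝ}
    (hH : ∀ x, (t, x) ∈ U → H x = coframeForm 1 fun a => ε a (t, x)) {X : Fin 3 → E}
    (hX : IsDualFrame (fun a => ε a (t, x)) X) :
    ∑ a, ricciFlat H x (X a) (X a) =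
      -2 * (fderiv ℝ (ψ 1) (t, x) (0, X 1) (X 0) - fderiv ℝ (ψ 1) (t, x) (0, X 0) (X 1)
        + (fderiv ℝ (ψ 2) (t, x) (0, X 2) (X 0) - fderiv ℝ (ψ 2) (t, x) (0, X 0) (X 2))
        + (ψ 1 (t, x) (X 1) * ψ 2 (t, x) (X 2) - ψ 1 (t, x) (X 2) * ψ 2 (t, x) (X 1))) := by
  simp only [(h.isCartanFrame_slice t).ricciFlat_eq hH hx hX, hX.dual, Fin.sum_univ_three]
  have hf : ∀ a, fderiv ℝ (fun x => ψ a (t, x)) x = _ := fun a =>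
    (hasFDerivAt_slice (h.differentiableAt_shape hx a)).fderiv
  simp [curvatureForm, spaceConnection, Fin.sum_univ_three, fderiv_neg, hf]
  ring

/-- `dκ_0 = 0`: its space-space part is `closed`, its time-space part is `shape_evolution`. -/
theorem connectionForm_closed (h : IsCoordinateFlow b ε ψ l U) (hy : y ∈ U) (z v : ℝ × E) :
    fderiv ℝ (connectionForm ψ l 0) y z v = fderiv ℝ (connectionForm ψ l 0) y v z := by
  rw [fderiv_connectionForm (h.differentiableAt_shape hy) (h.differentiableAt_dlapse hy),
    fderiv_connectionForm (h.differentiableAt_shape hy) (h.differentiableAt_dlapse hy),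
    apply_eq_time_add_space (fderiv ℝ (ψ 0) y) z, apply_eq_time_add_space (fderiv ℝ (ψ 0) y) v,
    apply_eq_time_add_space (fderiv ℝ (l 0) y) z, apply_eq_time_add_space (fderiv ℝ (l 0) y) v]
  simp only [add_apply, smul_apply, smul_eq_mul]
  linear_combination z.1 * h.shape_evolution y hy v.2 - v.1 * h.shape_evolution y hy z.2
    + h.closed y hy z.2 v.2

/-- The Ricci tensor of the space-time metric is a multiple of the square of the null form
`b dt + ε 0`. -/
theorem ricciFlat_time [FiniteDimensional ℝ E] (h : IsCoordinateFlow b ε ψ l U) (hy : y ∈ U)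
    {G : ℝ × E → ℝ × E →L[ℝ] ℝ × E →L[ℝ] ℝ}
    (hG : ∀ y ∈ U, G y = coframeForm ![-1, 1, 1, 1] fun i => timeCoframe b ε i y) {X : Fin 3 → E}
    (hX : IsDualFrame (fun a => ε a y) X) (v w : ℝ × E) :
    ricciFlat G y v w =
      -(fderiv ℝ (ψ 1) y (0, X 1) (X 0) - fderiv ℝ (ψ 1) y (0, X 0) (X 1)
        + (fderiv ℝ (ψ 2) y (0, X 2) (X 0) - fderiv ℝ (ψ 2) y (0, X 0) (X 2))
        + (ψ 0 y (X 1) * ψ 1 y (X 0) - ψ 0 y (X 0) * ψ 1 y (X 1))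
        + (ψ 0 y (X 2) * ψ 2 y (X 0) - ψ 0 y (X 0) * ψ 2 y (X 2)))
      * ((b y * v.1 + ε 0 y v.2) * (b y * w.1 + ε 0 y w.2)) := by
  have hC := h.isCartanFrame_time
  have hXt := isDualFrame_timeFrame (h.lapse_pos y hy).ne' hX
  set κ := connectionForm ψ l with hκ
  have h01 : ∀ z v, fderiv ℝ (κ 0) y z v = fderiv ℝ (κ 0) y v z := h.connectionForm_closed hy
  set P : Fin 3 → ℝ × E → ℝ × E → ℝ := fun a z v =>
    fderiv ℝ (κ a) y z v - fderiv ℝ (κ a) y v z + (κ 0 y z * κ a y v - κ 0 y v * κ a y z) with hP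
  have hPanti : ∀ a z v, P a z v = -P a v z := fun a z v => by simp only [hP]; ring
  -- The curvature consists of null rotations fixing `k`: the `(0, 1)` entry is `dκ_0 = 0`, and in
  -- the `(2, 3)` entry the two products `κ 1 ∧ κ 2` cancel.
  have hF : ∀ i k z v, curvatureForm (timeConnection κ) y i k z v =
      (![![0, 0, P 1 z v, P 2 z v], ![0, 0, -P 1 z v, -P 2 z v], ![P 1 z v, P 1 z v, 0, 0],
        ![P 2 z v, P 2 z v, 0, 0]] : Matrix (Fin 4) (Fin 4) ℝ) i k := by
    intro i k z v
    fin_cases i <;> fin_cases k <;>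
      simp [curvatureForm, timeConnection, Fin.sum_univ_four, fderiv_neg, hP, h01 z v] <;> ring
  set k : ℝ × E → ℝ := fun v => b y * v.1 + ε 0 y v.2 with hk
  have e0 : ∀ v, timeCoframe b ε 0 y v = b y * v.1 := fun v => timeCoframe_zero_apply v
  have e1 : ∀ v, timeCoframe b ε 1 y v = ε 0 y v.2 := fun v => timeCoframe_succ_apply 0 v
  have e2 : ∀ v, timeCoframe b ε 2 y v = ε 1 y v.2 := fun v => timeCoframe_succ_apply 1 v
  have e3 : ∀ v, timeCoframe b ε 3 y v = ε 2 y v.2 := fun v => timeCoframe_succ_apply 2 v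
  -- Rows 2 and 3 of the Bianchi identity say `P a ∧ k = 0`; row 0 says `P 1 ∧ ε 1 + P 2 ∧ ε 2 = 0`.
  have hB1 : ∀ z v w, P 1 z v * k w + P 1 v w * k z + P 1 w z * k v = 0 := fun z v w => by
    have := hC.curvatureForm_bianchi hG hy 2 z v w
    simp only [Fin.sum_univ_four, hF, e0, e1, e2, e3] at this
    simp at this
    simp only [hk]
    linear_combination this
  have hB2 : ∀ z v w, P 2 z v * k w + P 2 v w * k z + P 2 w z * k v = 0 := fun z v w => by
    have := hC.curvatureForm_bianchi hG hy 3 z v w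
    simp only [Fin.sum_univ_four, hF, e0, e1, e2, e3] at this
    simp at this
    simp only [hk]
    linear_combination this
  have hB0 : ∀ z v w, P 1 z v * ε 1 y w.2 + P 1 v w * ε 1 y z.2 + P 1 w z * ε 1 y v.2
      + (P 2 z v * ε 2 y w.2 + P 2 v w * ε 2 y z.2 + P 2 w z * ε 2 y v.2) = 0 := fun z v w => by
    have := hC.curvatureForm_bianchi hG hy 0 z v w
    simp only [Fin.sum_univ_four, hF, e0, e1, e2, e3] at this
    simp at this
    linear_combination this
  have hb := (h.lapse_pos y hy).ne'
  have hd := hX.dual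
  set T : Fin 4 → ℝ × E := timeFrame (b y) X with hT
  have t0 : T 0 = ((b y)⁻¹, 0) := rfl
  have t1 : T 1 = (0, X 0) := rfl
  have t2 : T 2 = (0, X 1) := rfl
  have t3 : T 3 = (0, X 2) := rfl
  have k0 : k (T 0) = 1 := by simp [hk, t0, hb]
  have k1 : k (T 1) = 1 := by simp [hk, t1, hd]
  have k2 : k (T 2) = 0 := by simp [hk, t2, hd]
  have k3 : k (T 3) = 0 := by simp [hk, t3, hd]
  -- `ε 1` and `ε 2` vanish on `T 0` and `T 1`, so adding `T 2` or `T 3` as third argument isolates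
  -- one component.
  have hP1 : P 1 (T 0) (T 1) = 0 := by
    have := hB0 (T 0) (T 1) (T 2)
    simpa [t0, t1, t2, hd] using this
  have hP2 : P 2 (T 0) (T 1) = 0 := by
    have := hB0 (T 0) (T 1) (T 3)
    simpa [t0, t1, t3, hd] using this
  -- `T 0 - T 1` is annihilated by `k`. This equality makes the first two rows cancel in the Ricci
  -- trace.
  have hQ1 : P 1 (T 0) v = P 1 (T 1) v := by
    have := hB1 (T 0) v (T 1)
    rw [k0, k1, hPanti 1 v, hPanti 1 (T 1) (T 0), hP1] at this
    linarith
  have hQ2 : P 2 (T 0) v = P 2 (T 1) v := by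
    have := hB2 (T 0) v (T 1)
    rw [k0, k1, hPanti 2 v, hPanti 2 (T 1) (T 0), hP2] at this
    linarith
  -- Since `k` vanishes on `T 2`, the identity `P 1 ∧ k = 0` forces the contraction with `T 2` to be
  -- a multiple of `k`.
  have hR1 : P 1 (T 2) v = P 1 (T 2) (T 1) * k v := by
    have := hB1 (T 2) v (T 1)
    rw [k1, k2, hPanti 1 (T 1) (T 2)] at this
    linarith
  have hR2 : P 2 (T 3) v = P 2 (T 3) (T 1) * k v := by
    have := hB2 (T 3) v (T 1)
    rw [k1, k3, hPanti 2 (T 1) (T 3)] at this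
    linarith
  have hval : ∀ a u u', P a (0, u) (0, u') = fderiv ℝ (ψ a) y (0, u) u'
      - fderiv ℝ (ψ a) y (0, u') u + (ψ 0 y u * ψ a y u' - ψ 0 y u' * ψ a y u) := by
    intro a u u'
    simp only [hP, hκ, connectionForm_apply,
      fderiv_connectionForm (h.differentiableAt_shape hy) (h.differentiableAt_dlapse hy)]
    ring
  have hRic : ricciFlat G y v w = -(P 1 (T 2) v + P 2 (T 3) v) * k w := by
    rw [hC.ricciFlat_eq hG hy hXt]
    simp only [Fin.sum_univ_four, hF, e0, e1, e2, e3]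
    simp only [Matrix.cons_val, hQ1, hQ2, hk]
    ring
  rw [hRic, hR1, hR2, t1, t2, t3, hval, hval]
  ring

end IsCoordinateFlow

end CoordinateFlow

/-! ### Differential calculus in charts -/

section Charts

variable {E : Type*} [NormedAddCommGroup E] [NormedSpace ℝ E]
  {H : Type*} [TopologicalSpace H] (I : ModelWithCorners ℝ E H)
  {N : Type*} [TopologicalSpace N] [ChartedSpace H N] [IsManifold I ∞ N]
  (q : N) {x : E} {p : N}

theorem contMDiffAt_chart (hp : p ∈ (extChartAt I q).source) :
    ContMDiffAt I 𝓘(ℝ, E) ∞ (extChartAt I q) p :=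
  contMDiffAt_extChartAt' (by rwa [extChartAt_source] at hp)

theorem mdifferentiableAt_chart (hp : p ∈ (extChartAt I q).source) :
    MDifferentiableAt I 𝓘(ℝ, E) (extChartAt I q) p :=
  (contMDiffAt_chart I q hp).mdifferentiableAt (by simp)

variable [I.Boundaryless]

theorem contMDiffAt_chart_symm (hx : x ∈ (extChartAt I q).target) :
    ContMDiffAt 𝓘(ℝ, E) I ∞ (extChartAt I q).symm x :=
  (contMDiffOn_extChartAt_symm q).contMDiffAt ((isOpen_extChartAt_target q).mem_nhds hx)

theorem mdifferentiableAt_chart_symm (hx : x ∈ (extChartAt I q).target) :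
    MDifferentiableAt 𝓘(ℝ, E) I (extChartAt I q).symm x :=
  (contMDiffAt_chart_symm I q hx).mdifferentiableAt (by simp)

theorem mfderiv_chart_comp_symm (hx : x ∈ (extChartAt I q).target) (v : E) :
    mfderiv I 𝓘(ℝ, E) (extChartAt I q) ((extChartAt I q).symm x)
      (mfderiv 𝓘(ℝ, E) I (extChartAt I q).symm x v) = v := by
  have := mfderiv_extChartAt_comp_mfderivWithin_extChartAt_symm (I := I) hx
  rw [I.range_eq_univ, mfderivWithin_univ] at this
  exact congrArg (fun L => L v) this

theorem mfderiv_symm_comp_chart (hx : x ∈ (extChartAt I q).target)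
    (v : TangentSpace I ((extChartAt I q).symm x)) :
    mfderiv 𝓘(ℝ, E) I (extChartAt I q).symm x
      (mfderiv I 𝓘(ℝ, E) (extChartAt I q) ((extChartAt I q).symm x) v) = v := by
  have := mfderivWithin_extChartAt_symm_comp_mfderiv_extChartAt (I := I) hx
  rw [I.range_eq_univ, mfderivWithin_univ] at this
  exact congrArg (fun L => L v) this

/-- A one-form in terms of its coordinate expression. -/
theorem apply_eq_chartForm (α : ∀ p : N, TangentSpace I p →L[ℝ] ℝ)
    (hp : p ∈ (extChartAt I q).source) (v : TangentSpace I p) :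
    α p v = chartForm I α q (extChartAt I q p) (mfderiv I 𝓘(ℝ, E) (extChartAt I q) p v) := by
  obtain ⟨x, hx, rfl⟩ : ∃ x ∈ (extChartAt I q).target, (extChartAt I q).symm x = p :=
    ⟨_, (extChartAt I q).map_source hp, (extChartAt I q).left_inv hp⟩
  rw [(extChartAt I q).right_inv hx]
  exact congrArg _ (mfderiv_symm_comp_chart I q hx v).symm

/-- The differential of a function in a chart. -/
theorem dFun_apply_chart {f : N → ℝ} (hx : x ∈ (extChartAt I q).target)
    (hf : DifferentiableAt ℝ (fun x => f ((extChartAt I q).symm x)) x) (v : E) :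
    dFun I f ((extChartAt I q).symm x) (mfderiv 𝓘(ℝ, E) I (extChartAt I q).symm x v) =
      fderiv ℝ (fun x => f ((extChartAt I q).symm x)) x v := by
  have hs := (extChartAt I q).map_target hx
  have hf' : MDifferentiableAt I 𝓘(ℝ, ℝ) f ((extChartAt I q).symm x) := by
    have h1 : MDifferentiableAt 𝓘(ℝ, E) 𝓘(ℝ, ℝ) (fun x => f ((extChartAt I q).symm x))
        (extChartAt I q ((extChartAt I q).symm x)) := by
      rw [(extChartAt I q).right_inv hx]
      exact hf.mdifferentiableAt
    refine (h1.comp _ (mdifferentiableAt_chart I q hs)).congr_of_eventuallyEq ?_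
    filter_upwards [(isOpen_extChartAt_source q).mem_nhds hs] with p hp
    simp only [Function.comp_apply, (extChartAt I q).left_inv hp]
  have h2 := mfderiv_comp x hf' (mdifferentiableAt_chart_symm I q hx)
  have h3 : mfderiv 𝓘(ℝ, E) 𝓘(ℝ, ℝ) (f ∘ (extChartAt I q).symm) x =
    fderiv ℝ (fun x => f ((extChartAt I q).symm x)) x := mfderiv_eq_fderiv
  rw [h3] at h2
  exact (congrArg (fun L => L v) h2).symm

/-- The exterior derivative may be computed in any chart. -/
theorem extD_apply_chart {α : ∀ p : N, TangentSpace I p →L[ℝ] ℝ}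
    (hx : x ∈ (extChartAt I q).target) (hα : DifferentiableAt ℝ (chartForm I α q) x) (v w : E) :
    extD I α ((extChartAt I q).symm x) (mfderiv 𝓘(ℝ, E) I (extChartAt I q).symm x v)
      (mfderiv 𝓘(ℝ, E) I (extChartAt I q).symm x w) =
      fderiv ℝ (chartForm I α q) x v w - fderiv ℝ (chartForm I α q) x w v := by
  set φ := extChartAt I q with hφ
  set p := φ.symm x with hp
  set φ' := extChartAt I p with hφ'
  have hps : p ∈ φ.source := φ.map_target hx
  have hps' : p ∈ φ'.source := mem_extChartAt_source p
  have hyt : φ' p ∈ φ'.target := φ'.map_source hps'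
  -- `extD` uses the chart around the point itself, so the two charts are compared through their
  -- transition map `τ`.
  set τ : E → E := fun y => φ (φ'.symm y) with hτ
  have hsymm : φ'.symm (φ' p) = p := φ'.left_inv hps'
  have hτp : τ (φ' p) = x := by simp only [hτ, hsymm]; exact φ.right_inv hx
  have hnear : ∀ᶠ y in 𝓝 (φ' p), y ∈ φ'.target ∧ φ'.symm y ∈ φ.source := by
    refine Filter.Eventually.and ((isOpen_extChartAt_target p).mem_nhds hyt) ?_
    refine (contMDiffAt_chart_symm I p hyt).continuousAt ?_
    rw [hsymm]
    exact (isOpen_extChartAt_source q).mem_nhds hps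
  have hτm : ∀ y, y ∈ φ'.target → φ'.symm y ∈ φ.source → ∀ v,
      fderiv ℝ τ y v = mfderiv I 𝓘(ℝ, E) φ (φ'.symm y) (mfderiv 𝓘(ℝ, E) I φ'.symm y v) := by
    intro y hy hy' v
    have h2 := mfderiv_comp y (mdifferentiableAt_chart I q hy')
      (mdifferentiableAt_chart_symm I p hy)
    have h3 : mfderiv 𝓘(ℝ, E) 𝓘(ℝ, E) (φ ∘ φ'.symm) y = fderiv ℝ τ y := mfderiv_eq_fderiv
    rw [h3] at h2
    exact congrArg (fun L => L v) h2
  have hτsm : ContDiffAt ℝ ∞ τ (φ' p) := by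
    rw [← contMDiffAt_iff_contDiffAt]
    have h1 : ContMDiffAt I 𝓘(ℝ, E) ∞ φ (φ'.symm (φ' p)) := by
      rw [hsymm]; exact contMDiffAt_chart I q hps
    exact h1.comp _ (contMDiffAt_chart_symm I p hyt)
  have heq : chartForm I α p =ᶠ[𝓝 (φ' p)] fun y => chartForm I α q (τ y) ∘L fderiv ℝ τ y := by
    filter_upwards [hnear] with y hy
    ext v
    rw [ContinuousLinearMap.comp_apply, hτm y hy.1 hy.2]
    exact apply_eq_chartForm I q α hy.2 _
  have hα' : HasFDerivAt (chartForm I α q) (fderiv ℝ (chartForm I α q) x) (τ (φ' p)) := by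
    rw [hτp]; exact hα.hasFDerivAt
  have hατ : HasFDerivAt (fun y => chartForm I α q (τ y)) _ (φ' p) :=
    hα'.comp (φ' p) (hτsm.differentiableAt (by simp)).hasFDerivAt
  have hD := hατ.clm_comp
      ((hτsm.fderiv_right (m := ∞) (by simp)).differentiableAt (by simp)).hasFDerivAt
  have hchart : ∀ v : E, fderiv ℝ τ (φ' p) (chartDeriv I p (mfderiv 𝓘(ℝ, E) I φ.symm x v)) = v := by
    intro v
    have h1 : MDifferentiableAt 𝓘(ℝ, E) 𝓘(ℝ, E) τ (φ' p) :=
      (hτsm.differentiableAt (by simp)).mdifferentiableAt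
    have h2 := mfderiv_comp p h1 (mdifferentiableAt_chart I p hps')
    have h3 : τ ∘ φ' =ᶠ[𝓝 p] φ := by
      filter_upwards [(isOpen_extChartAt_source p).mem_nhds hps'] with z hz
      simp only [Function.comp_apply, hτ, φ'.left_inv hz]
    rw [h3.mfderiv_eq, mfderiv_eq_fderiv] at h2
    have h4 := congrArg (fun L => L (mfderiv 𝓘(ℝ, E) I φ.symm x v)) h2
    refine Eq.trans h4.symm ?_
    exact mfderiv_chart_comp_symm I q hx v
  -- The pullback by `τ` contributes a second derivative of `τ`, which is symmetric and drops out of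
  -- the antisymmetrisation.
  have hs := hτsm.isSymmSndFDerivAt (by simp; exact WithTop.coe_le_coe.2 (le_top : (2 : ℕ∞) ≤ ⊤))
  have hmain : extD I α p (mfderiv 𝓘(ℝ, E) I φ.symm x v) (mfderiv 𝓘(ℝ, E) I φ.symm x w) =
      fderiv ℝ (chartForm I α p) (φ' p) (chartDeriv I p (mfderiv 𝓘(ℝ, E) I φ.symm x v))
        (chartDeriv I p (mfderiv 𝓘(ℝ, E) I φ.symm x w))
      - fderiv ℝ (chartForm I α p) (φ' p) (chartDeriv I p (mfderiv 𝓘(ℝ, E) I φ.symm x w))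
        (chartDeriv I p (mfderiv 𝓘(ℝ, E) I φ.symm x v)) := rfl
  rw [hmain, heq.fderiv_eq, hD.fderiv]
  simp only [add_apply, ContinuousLinearMap.comp_apply, ContinuousLinearMap.compL_apply,
    ContinuousLinearMap.flip_apply, hchart]
  rw [hs, hτp]
  ring

end Charts

/-! ### The flow in a chart -/

section FlowInChart

variable {S : Type*} [TopologicalSpace S] [ChartedSpace (EuclideanSpace ℝ (Fin 3)) S]

local notation "𝔼" => EuclideanSpace ℝ (Fin 3)

/-- The lapse in the chart around `q`. -/
def chartLapse (β : ℝ → S → ℝ) (q : S) (y : ℝ × 𝔼) : ℝ := β y.1 ((extChartAt (𝓡 3) q).symm y.2)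

/-- The coframe in the chart around `q`. -/
def chartCoframe (e : FormTriple S) (q : S) (a : Fin 3) (y : ℝ × 𝔼) : 𝔼 →L[ℝ] ℝ :=
  chartForm (𝓡 3) (e y.1 a) q y.2

/-- The one-forms `Θ(e_a)` in the chart around `q`. -/
def chartShapeForm (β : ℝ → S → ℝ) (e : FormTriple S) (q : S) (a : Fin 3) (y : ℝ × 𝔼) :
    𝔼 →L[ℝ] ℝ :=
  chartForm (𝓡 3) (fun p => shapeForm β e y.1 p (e y.1 a p)) q y.2

/-- The functions `dβ(e_a)` in the chart around `q`. -/
def chartDLapse (β : ℝ → S → ℝ) (e : FormTriple S) (q : S) (a : Fin 3) (y : ℝ × 𝔼) : ℝ :=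
  dLapse β e y.1 ((extChartAt (𝓡 3) q).symm y.2) (e y.1 a ((extChartAt (𝓡 3) q).symm y.2))

/-- The spatial metric in the chart around `q`. -/
def chartMetric (e : FormTriple S) (q : S) (y : ℝ × 𝔼) : 𝔼 →L[ℝ] 𝔼 →L[ℝ] ℝ :=
  coframeForm 1 fun a => chartCoframe e q a y

theorem hMetric_eq (e : FormTriple S) (t : ℝ) (p : S) :
    hMetric e t p = coframeForm 1 fun a => e t a p := by
  simp [hMetric, coframeForm, tens]

theorem chartCoframe_apply (e : FormTriple S) (q : S) (a : Fin 3) (t : ℝ) (x v : 𝔼) :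
    chartCoframe e q a (t, x) v =
      e t a ((extChartAt (𝓡 3) q).symm x)
        (mfderiv 𝓘(ℝ, 𝔼) (𝓡 3) (extChartAt (𝓡 3) q).symm x v) := rfl

theorem chartBilin_hMetric (e : FormTriple S) (q : S) (t : ℝ) (x : 𝔼) :
    chartBilin (𝓡 3) (hMetric e t) q x = chartMetric e q (t, x) := by
  ext v w
  simp only [chartMetric, coframeForm_apply, chartCoframe_apply]
  have := coframeForm_apply 1 (fun a => e t a ((extChartAt (𝓡 3) q).symm x))
    (mfderiv 𝓘(ℝ, 𝔼) (𝓡 3) (extChartAt (𝓡 3) q).symm x v)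
    (mfderiv 𝓘(ℝ, 𝔼) (𝓡 3) (extChartAt (𝓡 3) q).symm x w)
  rw [← hMetric_eq] at this
  exact this

variable {β : ℝ → S → ℝ} {e : FormTriple S} {J : Set ℝ}

theorem sharp_coframe {t : ℝ} {p : S} {X : Fin 3 → TangentSpace (𝓡 3) p}
    (hX : IsDualFrame (fun a => e t a p) X) (a : Fin 3) :
    sharp (𝓡 3) (hMetric e t p) (e t a p) = X a := by
  refine hX.ext fun i => ?_
  have := hX.apply_inverse_coframeForm (ε := 1) (by simp) (e t a p) i
  simp only [sharp, hMetric_eq]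
  rw [this, hX.dual, hX.dual]
  simp [eq_comm]

theorem inverse_chartMetric {q : S} {y : ℝ × 𝔼} {Y : Fin 3 → 𝔼}
    (hY : IsDualFrame (fun a => chartCoframe e q a y) Y) (a : Fin 3) :
    (chartMetric e q y).inverse (chartCoframe e q a y) = Y a := by
  refine hY.ext fun i => ?_
  have := hY.apply_inverse_coframeForm (ε := 1) (by simp) (chartCoframe e q a y) i
  rw [chartMetric, this, hY.dual, hY.dual]
  simp [eq_comm]

namespace IsParallelSpinorFlow

theorem exists_dualFrame (h : IsParallelSpinorFlow β e J) {t : ℝ} (ht : t ∈ J) (p : S) :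
    ∃ X : Fin 3 → TangentSpace (𝓡 3) p, IsDualFrame (fun a => e t a p) X := by
  have : FiniteDimensional ℝ (TangentSpace (𝓡 3) p) := inferInstanceAs (FiniteDimensional ℝ 𝔼)
  refine exists_isDualFrame (h.coframe_indep t ht p) ?_
  have : Module.finrank ℝ (TangentSpace (𝓡 3) p) = Module.finrank ℝ 𝔼 := rfl
  rw [this]
  simp

theorem contDiffOn_chartMetric (h : IsParallelSpinorFlow β e J) (q : S) :
    ContDiffOn ℝ ∞ (chartMetric e q) (J ×ˢ (extChartAt (𝓡 3) q).target) := by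
  have : ∀ i, ContDiffOn ℝ ∞ (chartCoframe e q i) (J ×ˢ (extChartAt (𝓡 3) q).target) :=
    fun i => h.coframe_smooth i q
  have h2 : ContDiffOn ℝ ∞ (fun y => ∑ i, (1 : Fin 3 → ℝ) i •
      (chartCoframe e q i y).smulRight (chartCoframe e q i y))
      (J ×ˢ (extChartAt (𝓡 3) q).target) :=
    ContDiffOn.sum fun i _ => ContDiffOn.const_smul _ ((this i).smulRight (this i))
  exact h2

theorem fderiv_chartMetric_symm (h : IsParallelSpinorFlow β e J) (hJ : IsOpen J) {q : S}
    {y : ℝ × 𝔼} (hy : y ∈ J ×ˢ (extChartAt (𝓡 3) q).target) (z : ℝ × 𝔼) (v w : 𝔼) :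
    fderiv ℝ (chartMetric e q) y z v w = fderiv ℝ (chartMetric e q) y z w v := by
  have hU := (hJ.prod (isOpen_extChartAt_target (I := 𝓡 3) q)).mem_nhds hy
  have hd := (((h.contDiffOn_chartMetric q).contDiffAt hU).differentiableAt (by simp)).hasFDerivAt
  have h1 : ∀ v w, HasFDerivAt (fun y => chartMetric e q y v w)
      (((fderiv ℝ (chartMetric e q) y).flip v).flip w) y := fun v w => by
    simpa using (hd.clm_apply (hasFDerivAt_const v y)).clm_apply (hasFDerivAt_const w y)
  have h2 : (fun y => chartMetric e q y v w) = fun y => chartMetric e q y w v := by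
    funext y
    simp only [chartMetric, coframeForm_apply]
    exact Finset.sum_congr rfl fun i _ => by ring
  have h3 := h1 v w
  rw [h2] at h3
  exact congrArg (fun L => L z) (h3.unique (h1 w v))

variable [IsManifold (𝓡 3) ∞ S]

/-- A frame at a point, transported to the chart around `q`. -/
theorem isDualFrame_chart {q : S} {t : ℝ} {x : 𝔼}
    (hx : x ∈ (extChartAt (𝓡 3) q).target)
    {X : Fin 3 → TangentSpace (𝓡 3) ((extChartAt (𝓡 3) q).symm x)}
    (hX : IsDualFrame (fun a => e t a ((extChartAt (𝓡 3) q).symm x)) X) :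
    IsDualFrame (fun a => chartCoframe e q a (t, x)) (fun a =>
      mfderiv (𝓡 3) 𝓘(ℝ, 𝔼) (extChartAt (𝓡 3) q) ((extChartAt (𝓡 3) q).symm x) (X a)) where
  dual i j := (congrArg (e t i ((extChartAt (𝓡 3) q).symm x))
    (mfderiv_symm_comp_chart (𝓡 3) q hx (X j))).trans (hX.dual i j)
  complete v := by
    have h1 := hX.complete (mfderiv 𝓘(ℝ, 𝔼) (𝓡 3) (extChartAt (𝓡 3) q).symm x v)
    have h2 := congrArg
      (mfderiv (𝓡 3) 𝓘(ℝ, 𝔼) (extChartAt (𝓡 3) q) ((extChartAt (𝓡 3) q).symm x)) h1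
    rw [mfderiv_chart_comp_symm (𝓡 3) q hx v, map_sum] at h2
    refine Eq.trans ?_ h2
    exact Finset.sum_congr rfl fun a _ => (map_smul _ _ _).symm

theorem contDiffOn_chartLapse (h : IsParallelSpinorFlow β e J) (q : S) :
    ContDiffOn ℝ ∞ (chartLapse β q) (J ×ˢ (extChartAt (𝓡 3) q).target) := by
  rw [← contMDiffOn_iff_contDiffOn]
  have h1 : ContMDiffOn 𝓘(ℝ, ℝ × 𝔼) (𝓡 3) ∞
      (fun y : ℝ × 𝔼 => (extChartAt (𝓡 3) q).symm y.2) (J ×ˢ (extChartAt (𝓡 3) q).target) :=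
    (contMDiffOn_extChartAt_symm q).comp contDiff_snd.contMDiff.contMDiffOn fun y hy => hy.2
  have h2 : ContMDiffOn 𝓘(ℝ, ℝ × 𝔼) 𝓘(ℝ, ℝ) ∞ (fun y : ℝ × 𝔼 => y.1)
      (J ×ˢ (extChartAt (𝓡 3) q).target) := contDiff_fst.contMDiff.contMDiffOn
  exact h.lapse_smooth.comp (h2.prodMk h1) fun y hy => ⟨hy.1, mem_univ _⟩

/-- The differential of the chart does not depend on time, so it commutes with `∂_t`. -/
theorem shape_apply (h : IsParallelSpinorFlow β e J) (hJ : IsOpen J) {q : S} {t : ℝ} {x : 𝔼}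
    (ht : t ∈ J) (hx : x ∈ (extChartAt (𝓡 3) q).target)
    (u w : TangentSpace (𝓡 3) ((extChartAt (𝓡 3) q).symm x)) :
    shape β e t ((extChartAt (𝓡 3) q).symm x) u w =
      -(1 / (2 * chartLapse β q (t, x))) * fderiv ℝ (chartMetric e q) (t, x) (1, 0)
        (mfderiv (𝓡 3) 𝓘(ℝ, 𝔼) (extChartAt (𝓡 3) q) ((extChartAt (𝓡 3) q).symm x) u)
        (mfderiv (𝓡 3) 𝓘(ℝ, 𝔼) (extChartAt (𝓡 3) q) ((extChartAt (𝓡 3) q).symm x) w) := by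
  let p := (extChartAt (𝓡 3) q).symm x
  let P : 𝔼 →L[ℝ] 𝔼 := mfderiv (𝓡 3) 𝓘(ℝ, 𝔼) (extChartAt (𝓡 3) q) p
  have hU := (hJ.prod (isOpen_extChartAt_target (I := 𝓡 3) q)).mem_nhds
    (show (t, x) ∈ J ×ˢ (extChartAt (𝓡 3) q).target from ⟨ht, hx⟩)
  have hd := hasDerivAt_time
    (((h.contDiffOn_chartMetric q).contDiffAt hU).differentiableAt (by simp))
  have hcurve : hCurve e p = fun s =>
      (ContinuousLinearMap.precomp ℝ P) ∘L (chartMetric e q (s, x) ∘L P) := by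
    funext s
    ext u w
    have h1 := coframeForm_apply 1 (fun a => e s a p) u w
    have h2 := coframeForm_apply 1 (fun a => chartCoframe e q a (s, x)) (P u) (P w)
    have h3 : ∀ a u, chartCoframe e q a (s, x) (P u) = e s a p u := fun a u =>
      congrArg (e s a p) (mfderiv_symm_comp_chart (𝓡 3) q hx u)
    simp only [h3] at h2
    refine Eq.trans ?_ h2.symm
    rw [← hMetric_eq] at h1
    exact h1
  have hd2 := (hasDerivAt_const t (ContinuousLinearMap.precomp ℝ P)).clm_comp
    (hd.clm_comp (hasDerivAt_const t P))
  have hderiv : ∀ u w : 𝔼, deriv (hCurve e p) t u w =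
      fderiv ℝ (chartMetric e q) (t, x) (1, 0) (P u) (P w) := fun u w => by
    rw [hcurve, hd2.deriv]
    simp only [ContinuousLinearMap.zero_comp, ContinuousLinearMap.comp_zero, zero_add, add_zero]
    rfl
  exact congrArg (fun r => -(1 / (2 * β t p)) * r) (hderiv u w)

/-- The vector dual to `e_a` in the chart around `q`. -/
theorem sharp_eq_chart (h : IsParallelSpinorFlow β e J) {q : S} {t : ℝ} {x : 𝔼}
    (ht : t ∈ J) (hx : x ∈ (extChartAt (𝓡 3) q).target) (a : Fin 3) :
    sharp (𝓡 3) (hMetric e t ((extChartAt (𝓡 3) q).symm x)) (e t a ((extChartAt (𝓡 3) q).symm x))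
      = mfderiv 𝓘(ℝ, 𝔼) (𝓡 3) (extChartAt (𝓡 3) q).symm x
        ((chartMetric e q (t, x)).inverse (chartCoframe e q a (t, x))) := by
  obtain ⟨X, hX⟩ := h.exists_dualFrame ht ((extChartAt (𝓡 3) q).symm x)
  rw [sharp_coframe hX, inverse_chartMetric (isDualFrame_chart hx hX)]
  exact (mfderiv_symm_comp_chart (𝓡 3) q hx (X a)).symm

/-- This expression involves only the lapse, the coframe, the metric and its time derivative, all
smooth; it is the source of the joint smoothness of `Θ(e_a)` in time and position. -/
theorem chartShapeForm_eq (h : IsParallelSpinorFlow β e J) (hJ : IsOpen J) {q : S} {t : ℝ} {x : 𝔼}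
    (ht : t ∈ J) (hx : x ∈ (extChartAt (𝓡 3) q).target) (a : Fin 3) :
    chartShapeForm β e q a (t, x) =
      (-(1 / (2 * chartLapse β q (t, x)))) • fderiv ℝ (chartMetric e q) (t, x) (1, 0)
        ((chartMetric e q (t, x)).inverse (chartCoframe e q a (t, x))) := by
  ext v
  have h1 := h.shape_apply hJ ht hx
    (sharp (𝓡 3) (hMetric e t ((extChartAt (𝓡 3) q).symm x)) (e t a ((extChartAt (𝓡 3) q).symm x)))
    (mfderiv 𝓘(ℝ, 𝔼) (𝓡 3) (extChartAt (𝓡 3) q).symm x v)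
  refine Eq.trans h1 ?_
  rw [h.sharp_eq_chart ht hx, mfderiv_chart_comp_symm (𝓡 3) q hx]
  erw [mfderiv_chart_comp_symm (𝓡 3) q hx]
  rfl

theorem chartDLapse_eq (h : IsParallelSpinorFlow β e J) (hJ : IsOpen J) {q : S} {t : ℝ} {x : 𝔼}
    (ht : t ∈ J) (hx : x ∈ (extChartAt (𝓡 3) q).target) (a : Fin 3) :
    chartDLapse β e q a (t, x) = fderiv ℝ (chartLapse β q) (t, x)
      (0, (chartMetric e q (t, x)).inverse (chartCoframe e q a (t, x))) := by
  have hU := (hJ.prod (isOpen_extChartAt_target (I := 𝓡 3) q)).mem_nhds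
    (show (t, x) ∈ J ×ˢ (extChartAt (𝓡 3) q).target from ⟨ht, hx⟩)
  have hd := hasFDerivAt_slice
    (((h.contDiffOn_chartLapse q).contDiffAt hU).differentiableAt (by simp))
  have h1 := dFun_apply_chart (𝓡 3) q (f := β t) hx hd.differentiableAt
    ((chartMetric e q (t, x)).inverse (chartCoframe e q a (t, x)))
  rw [← h.sharp_eq_chart ht hx] at h1
  refine Eq.trans h1 ?_
  exact congrArg (fun L : 𝔼 →L[ℝ] ℝ =>
    L ((chartMetric e q (t, x)).inverse (chartCoframe e q a (t, x)))) hd.fderiv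

theorem exists_dualFrame_chart (h : IsParallelSpinorFlow β e J) {q : S} {t : ℝ} {x : 𝔼}
    (ht : t ∈ J) (hx : x ∈ (extChartAt (𝓡 3) q).target) :
    ∃ Y, IsDualFrame (fun a => chartCoframe e q a (t, x)) Y :=
  let ⟨_, hX⟩ := h.exists_dualFrame ht ((extChartAt (𝓡 3) q).symm x)
  ⟨_, isDualFrame_chart hx hX⟩

theorem contDiffOn_sharp (h : IsParallelSpinorFlow β e J) (hJ : IsOpen J) (q : S) (a : Fin 3) :
    ContDiffOn ℝ ∞ (fun y => (chartMetric e q y).inverse (chartCoframe e q a y))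
      (J ×ˢ (extChartAt (𝓡 3) q).target) := by
  intro y hy
  have hU := (hJ.prod (isOpen_extChartAt_target (I := 𝓡 3) q)).mem_nhds hy
  obtain ⟨Y, hY⟩ := h.exists_dualFrame_chart hy.1 hy.2
  have hinv : (chartMetric e q y).IsInvertible :=
    hY.isInvertible_coframeForm (ε := 1) (by simp)
  have h1 : ContDiffAt ℝ ∞ (fun y => (chartMetric e q y).inverse) y :=
    hinv.contDiffAt_map_inverse.comp y ((h.contDiffOn_chartMetric q).contDiffAt hU)
  have h2 : ContDiffAt ℝ ∞ (chartCoframe e q a) y := (h.coframe_smooth a q).contDiffAt hU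
  exact (h1.clm_apply h2).contDiffWithinAt

theorem contDiffOn_chartShapeForm (h : IsParallelSpinorFlow β e J) (hJ : IsOpen J) (q : S)
    (a : Fin 3) :
    ContDiffOn ℝ ∞ (chartShapeForm β e q a) (J ×ˢ (extChartAt (𝓡 3) q).target) := by
  have hU := hJ.prod (isOpen_extChartAt_target (I := 𝓡 3) q)
  have h1 : ContDiffOn ℝ ∞ (fun y => fderiv ℝ (chartMetric e q) y (1, 0)
      ((chartMetric e q y).inverse (chartCoframe e q a y)))
      (J ×ˢ (extChartAt (𝓡 3) q).target) :=
    (((h.contDiffOn_chartMetric q).fderiv_of_isOpen hU (m := ∞) (by simp)).clm_apply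
      contDiffOn_const).clm_apply (h.contDiffOn_sharp hJ q a)
  have h2 : ContDiffOn ℝ ∞ (fun y => -(1 / (2 * chartLapse β q y)))
      (J ×ˢ (extChartAt (𝓡 3) q).target) := by
    refine (contDiffOn_const.div (contDiffOn_const.mul (h.contDiffOn_chartLapse q)) ?_).neg
    intro y hy
    exact mul_ne_zero two_ne_zero (h.lapse_pos y.1 hy.1 _).ne'
  exact (h2.smul h1).congr fun y hy => h.chartShapeForm_eq hJ hy.1 hy.2 a

theorem contDiffOn_chartDLapse (h : IsParallelSpinorFlow β e J) (hJ : IsOpen J) (q : S)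
    (a : Fin 3) :
    ContDiffOn ℝ ∞ (chartDLapse β e q a) (J ×ˢ (extChartAt (𝓡 3) q).target) := by
  have hU := hJ.prod (isOpen_extChartAt_target (I := 𝓡 3) q)
  have h1 : ContDiffOn ℝ ∞ (fun y => fderiv ℝ (chartLapse β q) y
      (0, (chartMetric e q y).inverse (chartCoframe e q a y)))
      (J ×ˢ (extChartAt (𝓡 3) q).target) :=
    ((h.contDiffOn_chartLapse q).fderiv_of_isOpen hU (m := ∞) (by simp)).clm_apply
      (contDiffOn_const.prodMk (h.contDiffOn_sharp hJ q a))
  exact h1.congr fun y hy => h.chartDLapse_eq hJ hy.1 hy.2 a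

/-- A parallel spinor flow satisfies the flow equations in every chart. -/
theorem isCoordinateFlow (h : IsParallelSpinorFlow β e J) (hJ : IsOpen J) (q : S) :
    IsCoordinateFlow (chartLapse β q) (chartCoframe e q) (chartShapeForm β e q)
      (chartDLapse β e q) (J ×ˢ (extChartAt (𝓡 3) q).target) where
  isOpen := hJ.prod (isOpen_extChartAt_target q)
  lapse_smooth := h.contDiffOn_chartLapse q
  coframe_smooth a := h.coframe_smooth a q
  shape_smooth := h.contDiffOn_chartShapeForm hJ q
  dlapse_smooth := h.contDiffOn_chartDLapse hJ q
  lapse_pos y hy := h.lapse_pos y.1 hy.1 _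
  exists_dual y hy := h.exists_dualFrame_chart hy.1 hy.2
  shape_symm := by
    rintro ⟨t, x⟩ hy v w
    obtain ⟨Y, hY⟩ := h.exists_dualFrame_chart hy.1 hy.2
    -- `∑ Θ(e_a) ⊗ e_a` is `Θ` itself, and `∂_t h` inherits the symmetry of `h`.
    have hsum : ∀ v w, ∑ a, chartShapeForm β e q a (t, x) v * chartCoframe e q a (t, x) w =
        -(1 / (2 * chartLapse β q (t, x))) *
          fderiv ℝ (chartMetric e q) (t, x) (1, 0) w v := fun v w => by
      conv_rhs => rw [h.fderiv_chartMetric_symm hJ hy,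
        hY.apply_eq_sum (fderiv ℝ (chartMetric e q) (t, x) (1, 0) v) w, Finset.mul_sum]
      refine Finset.sum_congr rfl fun a _ => ?_
      rw [h.chartShapeForm_eq hJ hy.1 hy.2, inverse_chartMetric hY, smul_apply,
        h.fderiv_chartMetric_symm hJ hy, smul_eq_mul, mul_assoc]
    rw [hsum, hsum, h.fderiv_chartMetric_symm hJ hy]
  dlapse := by
    rintro ⟨t, x⟩ hy v
    obtain ⟨Y, hY⟩ := h.exists_dualFrame_chart hy.1 hy.2
    refine (hY.apply_eq_sum (fderiv ℝ (chartLapse β q) (t, x) ∘L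
      ContinuousLinearMap.inr ℝ ℝ 𝔼) v).trans (Finset.sum_congr rfl fun a _ => ?_)
    rw [h.chartDLapse_eq hJ hy.1 hy.2, inverse_chartMetric hY]
    rfl
  evolution := by
    rintro ⟨t, x⟩ hy a v
    have hU := (hJ.prod (isOpen_extChartAt_target (I := 𝓡 3) q)).mem_nhds hy
    have h1 := h.evolution t hy.1 ((extChartAt (𝓡 3) q).symm x) a
      (mfderiv 𝓘(ℝ, 𝔼) (𝓡 3) (extChartAt (𝓡 3) q).symm x v)
    have hε : DifferentiableAt ℝ (chartCoframe e q a) (t, x) :=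
      ((h.coframe_smooth a q).contDiffAt hU).differentiableAt (by simp)
    have h2 := ((hasDerivAt_time hε).clm_apply (hasDerivAt_const t v)).deriv
    have hb := hasFDerivAt_slice
      (((h.contDiffOn_chartLapse q).contDiffAt hU).differentiableAt (by simp))
    have h3 : dFun (𝓡 3) (β t) ((extChartAt (𝓡 3) q).symm x)
        (mfderiv 𝓘(ℝ, 𝔼) (𝓡 3) (extChartAt (𝓡 3) q).symm x v) =
        fderiv ℝ (chartLapse β q) (t, x) (0, v) :=
      (dFun_apply_chart (𝓡 3) q (f := β t) hy.2 hb.differentiableAt v).trans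
        (congrArg (fun L : 𝔼 →L[ℝ] ℝ => L v) hb.fderiv)
    rw [h3] at h1
    rw [← h1]
    congr 2
    simp only [map_zero, add_zero] at h2
    exact h2.symm
  structure_eq := by
    rintro ⟨t, x⟩ hy a v w
    have hU := (hJ.prod (isOpen_extChartAt_target (I := 𝓡 3) q)).mem_nhds hy
    have hε : DifferentiableAt ℝ (chartCoframe e q a) (t, x) :=
      ((h.coframe_smooth a q).contDiffAt hU).differentiableAt (by simp)
    have hs := hasFDerivAt_slice hε
    have h1 := h.structure_eq t hy.1 ((extChartAt (𝓡 3) q).symm x) a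
      (mfderiv 𝓘(ℝ, 𝔼) (𝓡 3) (extChartAt (𝓡 3) q).symm x v)
      (mfderiv 𝓘(ℝ, 𝔼) (𝓡 3) (extChartAt (𝓡 3) q).symm x w)
    rw [extD_apply_chart (𝓡 3) q (α := e t a) hy.2 hs.differentiableAt] at h1
    have h2 : fderiv ℝ (chartForm (𝓡 3) (e t a) q) x = _ := hs.fderiv
    rw [h2] at h1
    exact h1
  closed := by
    rintro ⟨t, x⟩ hy v w
    have hU := (hJ.prod (isOpen_extChartAt_target (I := 𝓡 3) q)).mem_nhds hy
    obtain ⟨F, hF, hdF⟩ := h.exact t hy.1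
    have hF' : ContDiffOn ℝ ∞ (fun x => F ((extChartAt (𝓡 3) q).symm x))
        (extChartAt (𝓡 3) q).target := by
      rw [← contMDiffOn_iff_contDiffOn]
      exact hF.comp_contMDiffOn (contMDiffOn_extChartAt_symm q)
    have hFat : ∀ x ∈ (extChartAt (𝓡 3) q).target,
        ContDiffAt ℝ ∞ (fun x => F ((extChartAt (𝓡 3) q).symm x)) x := fun x hx =>
      hF'.contDiffAt ((isOpen_extChartAt_target q).mem_nhds hx)
    have hψ := hasFDerivAt_slice
      (((h.contDiffOn_chartShapeForm hJ q 0).contDiffAt hU).differentiableAt (by simp))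
    -- Exactness makes `Θ(e_u)` a differential on the slice; closedness is then the symmetry of the
    -- Hessian of `F` in the chart.
    have heq : (fun x => chartShapeForm β e q 0 (t, x)) =ᶠ[𝓝 x]
        fderiv ℝ (fun x => F ((extChartAt (𝓡 3) q).symm x)) := by
      filter_upwards [(isOpen_extChartAt_target (I := 𝓡 3) q).mem_nhds hy.2] with x hx
      ext v
      rw [← dFun_apply_chart (𝓡 3) q hx ((hFat x hx).differentiableAt (by simp)), hdF]
      rfl
    have h1 : ∀ v, fderiv ℝ (chartShapeForm β e q 0) (t, x) (0, v) =
        fderiv ℝ (fderiv ℝ (fun x => F ((extChartAt (𝓡 3) q).symm x))) x v := fun v => by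
      rw [← heq.fderiv_eq, hψ.fderiv]
      rfl
    rw [h1, h1]
    exact (hFat x hy.2).isSymmSndFDerivAt
      (by simp; exact WithTop.coe_le_coe.2 (le_top : (2 : ℕ∞) ≤ ⊤)) v w
  shape_evolution := by
    rintro ⟨t, x⟩ hy v
    have hU := (hJ.prod (isOpen_extChartAt_target (I := 𝓡 3) q)).mem_nhds hy
    have h1 := h.shape_evolution t hy.1 ((extChartAt (𝓡 3) q).symm x)
      (mfderiv 𝓘(ℝ, 𝔼) (𝓡 3) (extChartAt (𝓡 3) q).symm x v)
    have hψ : DifferentiableAt ℝ (chartShapeForm β e q 0) (t, x) :=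
      ((h.contDiffOn_chartShapeForm hJ q 0).contDiffAt hU).differentiableAt (by simp)
    have h2 := ((hasDerivAt_time hψ).clm_apply (hasDerivAt_const t v)).deriv
    have hl := hasFDerivAt_slice
      (((h.contDiffOn_chartDLapse hJ q 0).contDiffAt hU).differentiableAt (by simp))
    have h3 : dFun (𝓡 3) (fun p => dLapse β e t p (e t 0 p)) ((extChartAt (𝓡 3) q).symm x)
        (mfderiv 𝓘(ℝ, 𝔼) (𝓡 3) (extChartAt (𝓡 3) q).symm x v) =
        fderiv ℝ (chartDLapse β e q 0) (t, x) (0, v) :=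
      (dFun_apply_chart (𝓡 3) q hy.2 hl.differentiableAt v).trans
        (congrArg (fun L : 𝔼 →L[ℝ] ℝ => L v) hl.fderiv)
    rw [h3] at h1
    refine Eq.trans ?_ h1
    congr 1
    simp only [map_zero, add_zero] at h2
    exact h2.symm

end IsParallelSpinorFlow

end FlowInChart

/-! ### The Ricci tensor of the space-time -/

section SpaceTime

variable {S : Type*} [TopologicalSpace S] [ChartedSpace (EuclideanSpace ℝ (Fin 3)) S]

local notation "𝔼" => EuclideanSpace ℝ (Fin 3)

variable {β : ℝ → S → ℝ} {e : FormTriple S} {J : Set ℝ}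

theorem metricTrace_eq {t : ℝ} {p : S} {X : Fin 3 → TangentSpace (𝓡 3) p}
    (hX : IsDualFrame (fun a => e t a p) X)
    (T : TangentSpace (𝓡 3) p →L[ℝ] TangentSpace (𝓡 3) p →L[ℝ] ℝ) :
    metricTrace (𝓡 3) (hMetric e t p) T = ∑ a, T (X a) (X a) := by
  have : FiniteDimensional ℝ (TangentSpace (𝓡 3) p) := inferInstanceAs (FiniteDimensional ℝ 𝔼)
  rw [metricTrace, hX.trace_eq]
  refine Finset.sum_congr rfl fun a _ => ?_
  have := hX.apply_inverse_coframeForm (ε := 1) (by simp) (T (X a)) a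
  rw [← hMetric_eq, Pi.one_apply, one_mul] at this
  exact this

theorem metricNormSq_eq {t : ℝ} {p : S} {X : Fin 3 → TangentSpace (𝓡 3) p}
    (hX : IsDualFrame (fun a => e t a p) X)
    (T : TangentSpace (𝓡 3) p →L[ℝ] TangentSpace (𝓡 3) p →L[ℝ] ℝ) :
    metricNormSq (𝓡 3) (hMetric e t p) T = ∑ a, ∑ b, T (X a) (X b) * T (X b) (X a) := by
  have : FiniteDimensional ℝ (TangentSpace (𝓡 3) p) := inferInstanceAs (FiniteDimensional ℝ 𝔼)
  have hr : ∀ a v, e t a p (raise (𝓡 3) (hMetric e t p) T v) = T v (X a) := fun a v => by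
    have := hX.apply_inverse_coframeForm (ε := 1) (by simp) (T v) a
    rw [← hMetric_eq, Pi.one_apply, one_mul] at this
    exact this
  rw [metricNormSq, hX.trace_eq]
  refine Finset.sum_congr rfl fun a _ => ?_
  rw [LinearMap.comp_apply, hr]
  conv_lhs => rw [← hX.complete (raise (𝓡 3) (hMetric e t p) T (X a))]
  simp [hr]

theorem dTime_apply (z : ℝ × S) (u : TangentSpace IM z) : dTime z u = u.1 := by
  rw [dTime, dFun, mfderiv_fst]
  rfl

theorem spaceForm_apply (a : Fin 3) (z : ℝ × S) (u : TangentSpace IM z) :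
    spaceForm e a z u = e z.1 a z.2 u.2 := by
  rw [spaceForm, mfderiv_snd]
  rfl

theorem gMetric_apply (z : ℝ × S) (u w : TangentSpace IM z) :
    gMetric β e z u w = -(β z.1 z.2 ^ 2 * (u.1 * w.1))
      + ∑ a, e z.1 a z.2 u.2 * e z.1 a z.2 w.2 := by
  simp [gMetric, tens, dTime_apply, spaceForm_apply]

theorem extChartAt_time (t : ℝ) (p : S) :
    extChartAt IM (t, p) = (PartialEquiv.refl ℝ).prod (extChartAt (𝓡 3) p) := by
  rw [extChartAt_prod, extChartAt_model_space_eq_id]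

variable [IsManifold (𝓡 3) ∞ S]

theorem mfderiv_time_chart (t : ℝ) (p : S) (u : TangentSpace IM (t, p)) :
    chartDeriv IM (t, p) u = (u.1, mfderiv (𝓡 3) 𝓘(ℝ, 𝔼) (extChartAt (𝓡 3) p) p u.2) := by
  have h1 : HasMFDerivAt IM 𝓘(ℝ, ℝ) (Prod.fst : ℝ × S → ℝ) (t, p) _ := hasMFDerivAt_fst (t, p)
  have h2 : HasMFDerivAt IM 𝓘(ℝ, 𝔼) (fun z : ℝ × S => extChartAt (𝓡 3) p z.2) (t, p) _ :=
    (mdifferentiableAt_chart (𝓡 3) p (mem_extChartAt_source p)).hasMFDerivAt.comp (t, p)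
      (hasMFDerivAt_snd (t, p))
  have h3 : HasMFDerivAt IM 𝓘(ℝ, ℝ × 𝔼) (fun z : ℝ × S => (z.1, extChartAt (𝓡 3) p z.2)) (t, p) _ :=
    h1.prodMk h2
  have h4 : (extChartAt IM (t, p) : ℝ × S → ℝ × 𝔼) = fun z => (z.1, extChartAt (𝓡 3) p z.2) := by
    rw [extChartAt_time]; rfl
  rw [chartDeriv, h4, h3.mfderiv]
  rfl

theorem mfderiv_time_chart_symm (p : S) {y : ℝ × 𝔼} (hy : y.2 ∈ (extChartAt (𝓡 3) p).target)
    (v : ℝ × 𝔼) :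
    mfderiv 𝓘(ℝ, ℝ × 𝔼) IM (fun y : ℝ × 𝔼 => (y.1, (extChartAt (𝓡 3) p).symm y.2)) y v =
      (v.1, mfderiv 𝓘(ℝ, 𝔼) (𝓡 3) (extChartAt (𝓡 3) p).symm y.2 v.2) := by
  have h1 : HasMFDerivAt 𝓘(ℝ, ℝ × 𝔼) 𝓘(ℝ, ℝ) (Prod.fst : ℝ × 𝔼 → ℝ) y _ :=
    hasFDerivAt_fst.hasMFDerivAt
  have h2 : HasMFDerivAt 𝓘(ℝ, ℝ × 𝔼) (𝓡 3)
      (fun y : ℝ × 𝔼 => (extChartAt (𝓡 3) p).symm y.2) y _ :=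
    (mdifferentiableAt_chart_symm (𝓡 3) p hy).hasMFDerivAt.comp y
      (hasFDerivAt_snd (𝕜 := ℝ) (E := ℝ) (F := 𝔼)).hasMFDerivAt
  rw [(h1.prodMk h2).mfderiv]
  rfl

theorem chartBilin_gMetric (t : ℝ) (p : S) {y : ℝ × 𝔼}
    (hy : y.2 ∈ (extChartAt (𝓡 3) p).target) :
    chartBilin IM (gMetric β e) (t, p) y =
      coframeForm ![-1, 1, 1, 1] fun i =>
        timeCoframe (chartLapse β p) (chartCoframe e p) i y := by
  refine ContinuousLinearMap.ext fun v => ContinuousLinearMap.ext fun w => ?_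
  -- The tangent spaces depend on the base point, so the inverse chart is generalised before its
  -- product form is substituted.
  have h1 : ∀ Ψ : ℝ × 𝔼 → ℝ × S, (extChartAt IM (t, p)).symm = Ψ →
      chartBilin IM (gMetric β e) (t, p) y v w =
        gMetric β e (Ψ y) (mfderiv 𝓘(ℝ, ℝ × 𝔼) IM Ψ y v) (mfderiv 𝓘(ℝ, ℝ × 𝔼) IM Ψ y w) := by
    rintro _ rfl
    rfl
  rw [h1 (fun y => (y.1, (extChartAt (𝓡 3) p).symm y.2)) (by rw [extChartAt_time]; rfl),
    mfderiv_time_chart_symm p hy, mfderiv_time_chart_symm p hy]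
  refine (gMetric_apply (y.1, (extChartAt (𝓡 3) p).symm y.2)
    (v.1, mfderiv 𝓘(ℝ, 𝔼) (𝓡 3) (extChartAt (𝓡 3) p).symm y.2 v.2)
    (w.1, mfderiv 𝓘(ℝ, 𝔼) (𝓡 3) (extChartAt (𝓡 3) p).symm y.2 w.2)).trans ?_
  have h2 : ∀ a : Fin 3, (![-1, 1, 1, 1] : Fin 4 → ℝ) a.succ = 1 := fun a => by
    fin_cases a <;> rfl
  have h3 : (coframeForm ![-1, 1, 1, 1] fun i =>
      timeCoframe (chartLapse β p) (chartCoframe e p) i y) v w =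
      -(chartLapse β p y ^ 2 * (v.1 * w.1))
        + ∑ a, chartCoframe e p a y v.2 * chartCoframe e p a y w.2 := by
    rw [coframeForm_apply, Fin.sum_univ_succ]
    simp only [timeCoframe_zero_apply, timeCoframe_succ_apply, h2, one_mul, Matrix.cons_val_zero]
    ring
  exact h3.symm

/-- A frame at `p`, in the chart around `p`. -/
theorem IsParallelSpinorFlow.isDualFrame_chart_self (h : IsParallelSpinorFlow β e J) {t : ℝ}
    (ht : t ∈ J) {p : S} {X : Fin 3 → TangentSpace (𝓡 3) p}
    (hX : IsDualFrame (fun a => e t a p) X) :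
    IsDualFrame (fun a => chartCoframe e p a (t, extChartAt (𝓡 3) p p))
      (fun a => mfderiv (𝓡 3) 𝓘(ℝ, 𝔼) (extChartAt (𝓡 3) p) p (X a)) := by
  obtain ⟨Y, hY⟩ := h.exists_dualFrame_chart (q := p) ht
    (mem_extChartAt_target (I := 𝓡 3) p)
  have hdual : ∀ i j, chartCoframe e p i (t, extChartAt (𝓡 3) p p)
      (mfderiv (𝓡 3) 𝓘(ℝ, 𝔼) (extChartAt (𝓡 3) p) p (X j)) = if i = j then 1 else 0 :=
    fun i j => (apply_eq_chartForm (𝓡 3) p (e t i) (mem_extChartAt_source p) (X j)).symm.trans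
      (hX.dual i j)
  exact hY.of_dual hdual

/-- Identifies the coefficient of `k ⊗ k` with half the Hamiltonian: `ricciFlat_time` and the slice
formula for the scalar curvature contain the same derivatives of `Θ(e_l)` and `Θ(e_n)`. -/
theorem IsParallelSpinorFlow.ricci_gMetric (h : IsParallelSpinorFlow β e J) (hJ : IsOpen J) {t : ℝ}
    (ht : t ∈ J) (p : S) (u w : TangentSpace IM (t, p)) :
    ricci IM (gMetric β e) (t, p) u w = (1 / 2 : ℝ) * hamiltonian β e t p *
      ((β t p * u.1 + e t 0 p u.2) * (β t p * w.1 + e t 0 p w.2)) := by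
  obtain ⟨X, hX⟩ := h.exists_dualFrame ht p
  have hY := h.isDualFrame_chart_self ht hX
  set x : 𝔼 := extChartAt (𝓡 3) p p with hx
  have hy : (t, x) ∈ J ×ˢ (extChartAt (𝓡 3) p).target := ⟨ht, mem_extChartAt_target p⟩
  let Y : Fin 3 → 𝔼 := fun a => mfderiv (𝓡 3) 𝓘(ℝ, 𝔼) (extChartAt (𝓡 3) p) p (X a)
  have hflow := h.isCoordinateFlow hJ p
  have hψ : ∀ a b, chartShapeForm β e p a (t, x) (Y b) = shape β e t p (X a) (X b) := by
    intro a b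
    refine (apply_eq_chartForm (𝓡 3) p (fun p => shapeForm β e t p (e t a p))
      (mem_extChartAt_source p) (X b)).symm.trans ?_
    simp only [shapeForm, sharp_coframe hX]
  have hε : ∀ v : TangentSpace (𝓡 3) p, chartCoframe e p 0 (t, x)
      (mfderiv (𝓡 3) 𝓘(ℝ, 𝔼) (extChartAt (𝓡 3) p) p v) = e t 0 p v := fun v =>
    (apply_eq_chartForm (𝓡 3) p (e t 0) (mem_extChartAt_source p) v).symm
  have hb : chartLapse β p (t, x) = β t p := by
    simp only [chartLapse, hx]
    rw [(extChartAt (𝓡 3) p).left_inv (mem_extChartAt_source p)]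
  have hsymm : ∀ a b, shape β e t p (X a) (X b) = shape β e t p (X b) (X a) := by
    intro a b
    have h1 := hflow.shape_symm _ hy (Y b) (Y a)
    have h2 : ∀ i j, chartCoframe e p i (t, x) (Y j) = if i = j then 1 else 0 := hY.dual
    simp only [h2, mul_ite, mul_one, mul_zero, Finset.sum_ite_eq', Finset.mem_univ, if_true,
      hψ] at h1
    exact h1
  have hR := hflow.ricciFlat_time hy (fun y hy => chartBilin_gMetric (β := β) (e := e) t p hy.2)
    (X := Y) hY (chartDeriv IM (t, p) u) (chartDeriv IM (t, p) w)
  have hS := hflow.sum_ricciFlat_slice hy (fun x _ => chartBilin_hMetric e p t x) (X := Y) hY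
  have hscal : scalarCurvature (𝓡 3) (hMetric e t) p =
      ∑ a, ricciFlat (chartBilin (𝓡 3) (hMetric e t) p) x (Y a) (Y a) :=
    metricTrace_eq hX _
  have hric : ricci IM (gMetric β e) (t, p) u w =
      ricciFlat (chartBilin IM (gMetric β e) (t, p)) (t, x) (chartDeriv IM (t, p) u)
        (chartDeriv IM (t, p) w) := by
    have : extChartAt IM (t, p) (t, p) = (t, x) := by rw [extChartAt_time]; rfl
    rw [← this]
    rfl
  have hk : ∀ u : TangentSpace IM (t, p), chartLapse β p (t, x) * (chartDeriv IM (t, p) u).1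
      + chartCoframe e p 0 (t, x) (chartDeriv IM (t, p) u).2 = β t p * u.1 + e t 0 p u.2 := by
    intro u
    rw [mfderiv_time_chart, hb]
    exact congrArg (fun r => β t p * u.1 + r) (hε u.2)
  simp only [hψ] at hR hS
  rw [hk, hk] at hR
  rw [hric, hR, hamiltonian, hscal, hS, metricTrace_eq hX, metricNormSq_eq hX]
  refine congrArg (· * ((β t p * u.1 + e t 0 p u.2) * (β t p * w.1 + e t 0 p w.2))) ?_
  simp only [Fin.sum_univ_three]
  -- With `Θ` symmetric, `Tr(Θ)² - |Θ|²` is twice the sum of the principal 2-minors. The `(l, n)`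
  -- minor cancels against the quadratic term of the scalar curvature, and the other two are those
  -- in `ricciFlat_time`.
  rw [hsymm 1 0, hsymm 2 0, hsymm 2 1]
  ring

end SpaceTime

/-! ### Existence of the potential -/

section Primitive

variable {E : Type*} [NormedAddCommGroup E] [NormedSpace ℝ E]
  {J : Set ℝ} {W : Set E} {k : ℝ × E → ℝ} {η : ℝ × E → E →L[ℝ] ℝ} {F : E → ℝ} {t₀ : ℝ}

theorem hasDerivAt_primitive_time (hJ : IsOpen J) (hJc : J.OrdConnected)
    (hk : ContDiffOn ℝ ∞ k (J ×ˢ W)) (ht₀ : t₀ ∈ J) {t : ℝ} {x : E} (ht : t ∈ J) (hx : x ∈ W) :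
    HasDerivAt (fun t => F x + ∫ s in t₀..t, k (s, x)) (k (t, x)) t := by
  have hkc : ContinuousOn (fun s => k (s, x)) J :=
    hk.continuousOn.comp (Continuous.prodMk_left x).continuousOn fun s hs => ⟨hs, hx⟩
  refine HasDerivAt.const_add _ (intervalIntegral.integral_hasDerivAt_right
    (hkc.mono (hJc.uIcc_subset ht₀ ht)).intervalIntegrable
    (hkc.stronglyMeasurableAtFilter hJ t ht) (hkc.continuousAt (hJ.mem_nhds ht)))

variable [FiniteDimensional ℝ E]

/-- Differentiation under the integral sign for a closed one-form `k dt + η`. -/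
theorem hasFDerivAt_primitive_space (hJ : IsOpen J) (hJc : J.OrdConnected) (hW : IsOpen W)
    (hk : ContDiffOn ℝ ∞ k (J ×ˢ W)) (hη : ContDiffOn ℝ ∞ η (J ×ˢ W))
    (hkη : ∀ y ∈ J ×ˢ W, ∀ v, fderiv ℝ η y (1, 0) v = fderiv ℝ k y (0, v)) (ht₀ : t₀ ∈ J)
    (hF : ∀ x ∈ W, HasFDerivAt F (η (t₀, x)) x) {t : ℝ} {x : E} (ht : t ∈ J) (hx : x ∈ W) :
    HasFDerivAt (fun x => F x + ∫ s in t₀..t, k (s, x)) (η (t, x)) x := by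
  have hU : IsOpen (J ×ˢ W) := hJ.prod hW
  have hsub : uIcc t₀ t ⊆ J := hJc.uIcc_subset ht₀ ht
  obtain ⟨r, hr, hball⟩ := Metric.nhds_basis_closedBall.mem_iff.1 (hW.mem_nhds hx)
  have hkd : ∀ y ∈ J ×ˢ W, DifferentiableAt ℝ k y := fun y hy =>
    (hk.contDiffAt (hU.mem_nhds hy)).differentiableAt (by simp)
  have hηd : ∀ y ∈ J ×ˢ W, DifferentiableAt ℝ η y := fun y hy =>
    (hη.contDiffAt (hU.mem_nhds hy)).differentiableAt (by simp)
  have hslice : ∀ x ∈ W, MapsTo (fun s => (s, x)) (uIcc t₀ t) (J ×ˢ W) :=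
    fun x hx s hs => ⟨hsub hs, hx⟩
  have hkc : ∀ x ∈ W, ContinuousOn (fun s => k (s, x)) (uIcc t₀ t) := fun x hx =>
    hk.continuousOn.comp (Continuous.prodMk_left x).continuousOn (hslice x hx)
  let k' : E → ℝ → E →L[ℝ] ℝ := fun x s => fderiv ℝ k (s, x) ∘L ContinuousLinearMap.inr ℝ ℝ E
  have hdk : ContinuousOn (fun y => fderiv ℝ k y ∘L ContinuousLinearMap.inr ℝ ℝ E) (J ×ˢ W) :=
    (hk.continuousOn_fderiv_of_isOpen hU (by simp)).clm_comp continuousOn_const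
  have hk'c : ∀ x ∈ W, ContinuousOn (k' x) (uIcc t₀ t) := fun x hx =>
    hdk.comp (Continuous.prodMk_left x).continuousOn (hslice x hx)
  -- Compactness of the time segment times a closed ball gives the constant dominating bound.
  obtain ⟨C, hC⟩ := (isCompact_uIcc.prod (isCompact_closedBall x r)).exists_bound_of_continuousOn
    (hdk.mono (prod_mono hsub hball))
  have hint : HasFDerivAt (fun x => ∫ s in t₀..t, k (s, x)) (∫ s in t₀..t, k' x s) x := by
    refine intervalIntegral.hasFDerivAt_integral_of_dominated_of_fderiv_le (𝕜 := ℝ)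
      (F := fun x s => k (s, x)) (F' := k') (bound := fun _ => C)
      (Metric.ball_mem_nhds x hr) ?_ (hkc x hx).intervalIntegrable ?_ ?_
      intervalIntegrable_const ?_
    · filter_upwards [hW.mem_nhds hx] with z hz
      exact ((hkc z hz).mono uIoc_subset_uIcc).aestronglyMeasurable measurableSet_uIoc
    · exact ((hk'c x hx).mono uIoc_subset_uIcc).aestronglyMeasurable measurableSet_uIoc
    · refine Filter.Eventually.of_forall fun s hs z hz => ?_
      exact hC (s, z) ⟨uIoc_subset_uIcc hs, Metric.ball_subset_closedBall hz⟩
    · refine Filter.Eventually.of_forall fun s hs z hz => ?_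
      exact hasFDerivAt_slice
        (hkd _ ⟨hsub (uIoc_subset_uIcc hs), hball (Metric.ball_subset_closedBall hz)⟩)
  -- Closedness replaces the spatial derivative of `k` by the time derivative of `η`, which
  -- integrates exactly.
  have hval : ∫ s in t₀..t, k' x s = η (t, x) - η (t₀, x) := by
    refine intervalIntegral.integral_eq_sub_of_hasDerivAt (f := fun s => η (s, x)) (fun s hs => ?_)
      (hk'c x hx).intervalIntegrable
    have hy : (s, x) ∈ J ×ˢ W := ⟨hsub hs, hx⟩
    have : k' x s = fderiv ℝ η (s, x) (1, 0) := by
      ext v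
      exact (hkη _ hy v).symm
    rw [this]
    exact hasDerivAt_time (hηd _ hy)
  have := (hF x hx).add hint
  rw [hval, add_sub_cancel] at this
  exact this

/-- The primitive of a closed one-form `k dt + η` is smooth. -/
theorem contDiffOn_primitive (hJ : IsOpen J) (hJc : J.OrdConnected) (hW : IsOpen W)
    (hk : ContDiffOn ℝ ∞ k (J ×ˢ W)) (hη : ContDiffOn ℝ ∞ η (J ×ˢ W))
    (hkη : ∀ y ∈ J ×ˢ W, ∀ v, fderiv ℝ η y (1, 0) v = fderiv ℝ k y (0, v)) (ht₀ : t₀ ∈ J)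
    (hF : ∀ x ∈ W, HasFDerivAt F (η (t₀, x)) x) :
    ContDiffOn ℝ ∞ (fun y : ℝ × E => F y.2 + ∫ s in t₀..y.1, k (s, y.2)) (J ×ˢ W) := by
  have hU : IsOpen (J ×ˢ W) := hJ.prod hW
  let f₁ : ℝ → E → ℝ →L[ℝ] ℝ := fun t x => ContinuousLinearMap.toSpanSingleton ℝ (k (t, x))
  let f₂ : ℝ → E → E →L[ℝ] ℝ := fun t x => η (t, x)
  have hf₁ : ContDiffOn ℝ ∞ (fun y : ℝ × E => f₁ y.1 y.2) (J ×ˢ W) :=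
    (ContinuousLinearMap.toSpanSingletonCLE (𝕜 := ℝ) (E := ℝ)).contDiff.comp_contDiffOn hk
  have hd : ∀ y ∈ J ×ˢ W, HasFDerivAt (fun y : ℝ × E => F y.2 + ∫ s in t₀..y.1, k (s, y.2))
      ((f₁ y.1 y.2).coprod (f₂ y.1 y.2)) y := by
    intro y hy
    -- Continuous partial derivatives give the total derivative `k dt + η`; as this form is smooth,
    -- so is the primitive.
    refine (hasStrictFDerivAt_uncurry_coprod (𝕜 := ℝ) (u := y)
      (f := fun t x => F x + ∫ s in t₀..t, k (s, x)) (f₁ := f₁) (f₂ := f₂) ?_ ?_ ?_ ?_).hasFDerivAt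
    · filter_upwards [hU.mem_nhds hy] with z hz
      exact (hasDerivAt_primitive_time hJ hJc hk ht₀ hz.1 hz.2).hasFDerivAt
    · filter_upwards [hU.mem_nhds hy] with z hz
      exact hasFDerivAt_primitive_space hJ hJc hW hk hη hkη ht₀ hF hz.1 hz.2
    · exact hf₁.continuousOn.continuousAt (hU.mem_nhds hy)
    · exact hη.continuousOn.continuousAt (hU.mem_nhds hy)
  rw [contDiffOn_infty_iff_fderiv_of_isOpen hU]
  refine ⟨fun y hy => (hd y hy).differentiableAt.differentiableWithinAt, ?_⟩
  have h2 : ContDiffOn ℝ ∞ (fun y : ℝ × E => f₁ y.1 y.2 ∘L ContinuousLinearMap.fst ℝ ℝ E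
      + η y ∘L ContinuousLinearMap.snd ℝ ℝ E) (J ×ˢ W) :=
    (hf₁.clm_comp contDiffOn_const).add (hη.clm_comp contDiffOn_const)
  refine h2.congr fun y hy => ?_
  rw [(hd y hy).fderiv]
  ext <;> simp [f₂]

end Primitive

section Potential

variable {S : Type*} [TopologicalSpace S] [ChartedSpace (EuclideanSpace ℝ (Fin 3)) S]
  [IsManifold (𝓡 3) ∞ S] {β : ℝ → S → ℝ} {e : FormTriple S} {J : Set ℝ}

local notation "𝔼" => EuclideanSpace ℝ (Fin 3)

/-- With `F` a primitive of `Θ(e_u)` at time `t₀`, the function `-F + ∫ dβ_s(e_u) ds` is globally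
defined. Its derivatives and its smoothness are local, so they are checked in charts. -/
theorem IsParallelSpinorFlow.exists_isPotential (h : IsParallelSpinorFlow β e J) (hJ : IsOpen J)
    (hJc : J.OrdConnected) : ∃ f : ℝ → S → ℝ, IsPotential β e J f := by
  rcases J.eq_empty_or_nonempty with rfl | ⟨t₀, ht₀⟩
  · exact ⟨0, fun z hz => hz.1.elim, fun t ht => ht.elim, fun t ht => ht.elim⟩
  obtain ⟨F, hF, hdF⟩ := h.exact t₀ ht₀
  have hW := fun q : S => isOpen_extChartAt_target (I := 𝓡 3) q
  have hk := fun q => h.contDiffOn_chartDLapse hJ q 0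
  have hη : ∀ q, ContDiffOn ℝ ∞ (fun y => -chartShapeForm β e q 0 y)
      (J ×ˢ (extChartAt (𝓡 3) q).target) := fun q => (h.contDiffOn_chartShapeForm hJ q 0).neg
  have hkη : ∀ q, ∀ y ∈ J ×ˢ (extChartAt (𝓡 3) q).target, ∀ v,
      fderiv ℝ (fun y => -chartShapeForm β e q 0 y) y (1, 0) v =
        fderiv ℝ (chartDLapse β e q 0) y (0, v) := fun q y hy v => by
    have := (h.isCoordinateFlow hJ q).shape_evolution y hy v
    rw [fderiv_fun_neg, neg_apply, neg_apply]
    linarith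
  have hF0 : ∀ q, ∀ x ∈ (extChartAt (𝓡 3) q).target,
      HasFDerivAt (fun x => -F ((extChartAt (𝓡 3) q).symm x))
        (-chartShapeForm β e q 0 (t₀, x)) x := fun q x hx => by
    have hFd : DifferentiableAt ℝ (fun x => F ((extChartAt (𝓡 3) q).symm x)) x :=
      ((hF.contMDiffAt.comp x (contMDiffAt_chart_symm (𝓡 3) q hx)).contDiffAt).differentiableAt
        (by simp)
    have : fderiv ℝ (fun x => F ((extChartAt (𝓡 3) q).symm x)) x =
        chartShapeForm β e q 0 (t₀, x) := by
      ext v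
      rw [← dFun_apply_chart (𝓡 3) q hx hFd, hdF]
      rfl
    rw [← this]
    exact hFd.hasFDerivAt.neg
  have hsource : ∀ q p : S, p ∈ (extChartAt (𝓡 3) q).source →
      ∃ x ∈ (extChartAt (𝓡 3) q).target, (extChartAt (𝓡 3) q).symm x = p := fun q p hp =>
    ⟨_, (extChartAt (𝓡 3) q).map_source hp, (extChartAt (𝓡 3) q).left_inv hp⟩
  refine ⟨fun t p => -F p + ∫ s in t₀..t, dLapse β e s p (e s 0 p), ?_, ?_, ?_⟩
  · rintro ⟨t, p⟩ ⟨ht, -⟩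
    refine ContMDiffAt.contMDiffWithinAt ?_
    have hx := mem_extChartAt_target (I := 𝓡 3) p
    have h1 := (contDiffOn_primitive hJ hJc (hW p) (hk p) (hη p) (hkη p) ht₀ (hF0 p)).contDiffAt
      ((hJ.prod (hW p)).mem_nhds (mk_mem_prod ht hx))
    have h4 : (extChartAt IM (t, p) : ℝ × S → ℝ × 𝔼) = fun z => (z.1, extChartAt (𝓡 3) p z.2) := by
      rw [extChartAt_time]; rfl
    have h2 : ContMDiffAt IM 𝓘(ℝ, ℝ × 𝔼) ∞ (fun z : ℝ × S => (z.1, extChartAt (𝓡 3) p z.2))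
        (t, p) := by
      rw [← h4]
      exact contMDiffAt_extChartAt
    have h3 := ContMDiffAt.comp (t, p) h1.contMDiffAt h2
    refine h3.congr_of_eventuallyEq ?_
    filter_upwards [continuousAt_snd.preimage_mem_nhds (extChartAt_source_mem_nhds (I := 𝓡 3) p)]
      with z hz
    have : (extChartAt (𝓡 3) p).symm (extChartAt (𝓡 3) p z.2) = z.2 :=
      (extChartAt (𝓡 3) p).left_inv hz
    have h5 : ∀ p', p' = z.2 → -F z.2 + ∫ s in t₀..z.1, dLapse β e s z.2 (e s 0 z.2) =
        -F p' + ∫ s in t₀..z.1, dLapse β e s p' (e s 0 p') := by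
      rintro _ rfl
      rfl
    exact h5 _ this
  · intro t ht p
    obtain ⟨q, hq⟩ : ∃ q, p ∈ (extChartAt (𝓡 3) q).source := ⟨p, mem_extChartAt_source p⟩
    obtain ⟨x, hx, rfl⟩ := hsource q p hq
    have h1 := hasFDerivAt_primitive_space hJ hJc (hW q) (hk q) (hη q) (hkη q) ht₀ (hF0 q) ht hx
    ext u
    obtain ⟨v, rfl⟩ : ∃ v : 𝔼, mfderiv 𝓘(ℝ, 𝔼) (𝓡 3) (extChartAt (𝓡 3) q).symm x v = u :=
      ⟨_, mfderiv_symm_comp_chart (𝓡 3) q hx u⟩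
    refine (dFun_apply_chart (𝓡 3) q hx h1.differentiableAt v).trans ?_
    exact congrArg (fun L : 𝔼 →L[ℝ] ℝ => L v) h1.fderiv
  · intro t ht p
    obtain ⟨q, hq⟩ : ∃ q, p ∈ (extChartAt (𝓡 3) q).source := ⟨p, mem_extChartAt_source p⟩
    obtain ⟨x, hx, rfl⟩ := hsource q p hq
    exact (hasDerivAt_primitive_time (F := fun x => -F ((extChartAt (𝓡 3) q).symm x)) hJ hJc (hk q)
      ht₀ ht hx).deriv

end Potential

end SpinorFlow

end

theorem mainTheorem6 {S : Type*} [TopologicalSpace S]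
    [ChartedSpace (EuclideanSpace ℝ (Fin 3)) S] [IsManifold (𝓡 3) ∞ S]
    (J : Set ℝ) (hJ_open : IsOpen J) (hJ_interval : J.OrdConnected)
    (β : ℝ → S → ℝ) (e : SpinorFlow.FormTriple S)
    (hflow : SpinorFlow.IsParallelSpinorFlow β e J) :
    (∃ f : ℝ → S → ℝ, SpinorFlow.IsPotential β e J f) ∧
    ∀ f : ℝ → S → ℝ, SpinorFlow.IsPotential β e J f →
      ∀ t ∈ J, ∀ p : S,
        SpinorFlow.ricci SpinorFlow.IM (SpinorFlow.gMetric β e) (t, p) =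
          ((1 / 2 : ℝ) * SpinorFlow.hamiltonian β e t p * Real.exp (-2 * f t p)) •
            SpinorFlow.tens SpinorFlow.IM (SpinorFlow.diracCurrent β e f (t, p))
              (SpinorFlow.diracCurrent β e f (t, p)) := by
  refine ⟨hflow.exists_isPotential hJ_open hJ_interval, fun f _ t ht p => ?_⟩
  refine ContinuousLinearMap.ext fun u => ContinuousLinearMap.ext fun w => ?_
  rw [hflow.ricci_gMetric hJ_open ht]
  -- `u ⊗ u = e^{2f} k ⊗ k`, so the factor `e^{-2f}` restores the null form `k`.
  have hexp : Real.exp (-2 * f t p) * (Real.exp (f t p) * Real.exp (f t p)) = 1 := by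
    rw [← Real.exp_add, ← Real.exp_add, Real.exp_eq_one_iff]
    ring
  simp only [SpinorFlow.tens, SpinorFlow.diracCurrent, smul_apply, add_apply, smul_eq_mul,
    ContinuousLinearMap.smulRight_apply, SpinorFlow.dTime_apply, SpinorFlow.spaceForm_apply]
  linear_combination (-(1 / 2 * SpinorFlow.hamiltonian β e t p *
    ((β t p * u.1 + e t 0 p u.2) * (β t p * w.1 + e t 0 p w.2)))) * hexp
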